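/- Let $l>-\frac12$ and let $q:(0,\infty)\to\mathbb R$ belong to the Marchenko class, that is, $q\in L^1_{\mathrm{loc}}((0,\infty))$, $\int_0^1 x|q(x)|\,dx<\infty$ and $\int_1^\infty x|q(x)|\,dx<\infty$. Consider the equation \[ -u''+\frac{l(l+1)}{x^2}u+q(x)u=zu,\qquad x>0 . \] For $z\in\mathbb C$ let $\phi(z,\cdot)$ be its regular solution, i.e. the unique solution of the form $\phi(z,x)=C_l x^{l+1}\tilde\phi(z,x)$ with $\tilde\phi(z,\cdot)\in W^{1,1}[0,1]$, $\tilde\phi(z,0)=1$, where $C_l=\frac{\sqrt\pi}{\Gamma(l+\frac32)2^{l+1}}$. For $k\in\mathbb R\setminus\{0\}$ let $f(k,\cdot)$ be the Jost solution, i.e. the unique solution with $z=k^2$ such that $f(k,x)=e^{ikx}(1+o(1))$ and $f'(k,x)=ike^{ikx}(1+o(1))$ as $x\to\infty$. Let $f(k)=f(k,x)\phi'(k^2,x)-f'(k,x)\phi(k^2,x)$ be the Jost function (this Wronskian does not depend on $x$), and let \[ F(k)=e^{-i\pi l/2}\,k^l f(k), \] where $k^l$ is taken with $\arg k\in[0,\pi]$.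 Then $F(k)\neq0$ for all $k\in\mathbb R\setminus\{0\}$, and \[ |F(k)|^{-1}=\mathcal O\bigl(|k|^{-\min(l+3/2,\,2)}\bigr)\qquad\text{as } k\to0,\ k\in\mathbb R\setminus\{0\}. \] -/

import Mathlib

open Filter Topology MeasureTheory Asymptotics

noncomputable section

namespace SphericalSchrodinger

/-- The Marchenko class: `q ∈ L¹_loc((0,∞))`, `∫₀¹ x |q(x)| dx < ∞` and
`∫₁^∞ x |q(x)| dx < ∞`. -/
structure MarchenkoClass (q : ℝ → ℝ) : Prop where
  locallyIntegrable : LocallyIntegrableOn q (Set.Ioi 0)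
  integrable_near_zero : IntegrableOn (fun x => x * |q x|) (Set.Ioc 0 1)
  integrable_at_top : IntegrableOn (fun x => x * |q x|) (Set.Ioi 1)

/-- `u` solves `-u'' + (l(l+1)/x² + q(x)) u = z u` on `(0,∞)` in the Carathéodory sense:
`u` is differentiable and `u'` is locally absolutely continuous on `(0,∞)` with
`u'' = (l(l+1)/x² + q - z) u` almost everywhere, which is written in integrated form.
(The integrand is integrable on `[a,b]`, since `u` is continuous and `q` locally integrable.) -/
structure IsSolution (l : ℝ) (q : ℝ → ℝ) (z : ℂ) (u : ℝ → ℂ) : Prop where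
  differentiableAt : ∀ x : ℝ, 0 < x → DifferentiableAt ℝ u x
  deriv_sub_deriv : ∀ a b : ℝ, 0 < a → 0 < b →
    deriv u b - deriv u a = ∫ x in a..b, (((l * (l + 1) / x ^ 2 + q x : ℝ) : ℂ) - z) * u x

/-- The constant `C_l = √π / (Γ(l + 3/2) 2^{l+1})`. -/
def regularConst (l : ℝ) : ℝ :=
  √Real.pi / (Real.Gamma (l + 3 / 2) * (2 : ℝ) ^ (l + 1))

/-- `u` is the regular solution at energy `z`: a solution of the form
`u(x) = C_l x^{l+1} v(x)` with `v ∈ W^{1,1}[0,1]` and `v(0) = 1`, that is,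
`v(x) = 1 + ∫₀ˣ g` with `g ∈ L¹(0,1)`. -/
structure IsRegularSolution (l : ℝ) (q : ℝ → ℝ) (z : ℂ) (u : ℝ → ℂ) : Prop where
  isSolution : IsSolution l q z u
  normalized : ∃ g : ℝ → ℂ, IntegrableOn g (Set.Ioc 0 1) ∧
    ∀ x ∈ Set.Ioc (0 : ℝ) 1,
      u x = ((regularConst l * x ^ (l + 1) : ℝ) : ℂ) * (1 + ∫ y in (0 : ℝ)..x, g y)

/-- `u` is the Jost solution at momentum `k`: it solves the equation with `z = k²` and
`u(x) = e^{ikx}(1 + o(1))`, `u'(x) = ik e^{ikx}(1 + o(1))` as `x → ∞`. -/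
structure IsJostSolution (l : ℝ) (q : ℝ → ℝ) (k : ℂ) (u : ℝ → ℂ) : Prop where
  isSolution : IsSolution l q (k ^ 2) u
  tendsto_value : Tendsto (fun x : ℝ => u x / Complex.exp (Complex.I * k * x)) atTop (𝓝 1)
  tendsto_deriv : Tendsto
    (fun x : ℝ => deriv u x / (Complex.I * k * Complex.exp (Complex.I * k * x))) atTop (𝓝 1)

open Classical in
/-- The regular solution `φ(z, ·)`; it is uniquely determined on `(0,∞)` by
`IsRegularSolution` (and set to `0` if there were none). -/
def regularSolution (l : ℝ) (q : ℝ → ℝ) (z : ℂ) : ℝ → ℂ :=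
  if h : ∃ u, IsRegularSolution l q z u then h.choose else 0

open Classical in
/-- The Jost solution `f(k, ·)`; for `Im k ≥ 0`, `k ≠ 0` it is uniquely determined on `(0,∞)` by
`IsJostSolution` (and set to `0` if there were none). -/
def jostSolution (l : ℝ) (q : ℝ → ℝ) (k : ℂ) : ℝ → ℂ :=
  if h : ∃ u, IsJostSolution l q k u then h.choose else 0

/-- The Wronskian `W(u,v)(x) = u(x) v'(x) - u'(x) v(x)`. -/
def wronskian (u v : ℝ → ℂ) (x : ℝ) : ℂ :=
  u x * deriv v x - deriv u x * v x

/-- The Jost function `f(k) = W(f(k,·), φ(k²,·))`. The Wronskian of two solutions with the same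
energy does not depend on the point `x > 0`; it is evaluated at `x = 1`. -/
def jostFunction (l : ℝ) (q : ℝ → ℝ) (k : ℂ) : ℂ :=
  wronskian (jostSolution l q k) (regularSolution l q (k ^ 2)) 1

/-- The normalized Jost function `F(k) = e^{-iπl/2} k^l f(k)` for `Im k ≥ 0`, `k ≠ 0`, where
`k^l` is taken with `0 ≤ arg k ≤ π` (this is the principal branch on `Im k ≥ 0`). -/
def normalizedJostFunction (l : ℝ) (q : ℝ → ℝ) (k : ℂ) : ℂ :=
  Complex.exp (-(Complex.I * (Real.pi * l / 2))) * k ^ (l : ℂ) * jostFunction l q k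

end SphericalSchrodinger

end

noncomputable section

namespace SphericalSchrodinger

open Set

/-! ### Weak derivatives on the half-line -/

/-- A Lipschitz function of an absolutely continuous function is absolutely continuous. -/
theorem absolutelyContinuousOnInterval_lipschitz_comp {f φ : ℝ → ℝ} {a b : ℝ} {C : NNReal}
    {s : Set ℝ} (hφ : LipschitzOnWith C φ s) (hf : AbsolutelyContinuousOnInterval f a b)
    (hs : MapsTo f (uIcc a b) s) : AbsolutelyContinuousOnInterval (fun x => φ (f x)) a b := by
  have h0 := Tendsto.const_mul (C : ℝ) hf
  rw [mul_zero] at h0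
  refine squeeze_zero' (Eventually.of_forall fun E => Finset.sum_nonneg fun i _ => dist_nonneg) ?_
    h0
  filter_upwards [mem_inf_of_right (mem_principal_self _)] with E hE
  rw [Finset.mul_sum]
  refine Finset.sum_le_sum fun i hi => ?_
  exact hφ.dist_le_mul _ (hs (hE.1 i hi).1) _ (hs (hE.1 i hi).2)

/-- `f` is locally absolutely continuous on `(0,∞)` with derivative `f'` almost everywhere. -/
def HasWeakDeriv (f f' : ℝ → ℝ) : Prop :=
  ∀ a b : ℝ, 0 < a → 0 < b →
    IntervalIntegrable f' volume a b ∧ f b - f a = ∫ x in a..b, f' x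

theorem uIcc_subset_Ioi {a b : ℝ} (ha : 0 < a) (hb : 0 < b) : uIcc a b ⊆ Ioi 0 := fun _ hx =>
  lt_of_lt_of_le (lt_min ha hb) hx.1

namespace HasWeakDeriv

variable {f f' g g' : ℝ → ℝ}

theorem eq_add (h : HasWeakDeriv f f') {a x : ℝ} (ha : 0 < a) (hx : 0 < x) :
    f x = f a + ∫ y in a..x, f' y := by
  rw [← (h a x ha hx).2]; ring

theorem congr (h : HasWeakDeriv f f') (hf : EqOn f g (Ioi 0)) (hf' : EqOn f' g' (Ioi 0)) :
    HasWeakDeriv g g' := by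
  intro a b ha hb
  obtain ⟨h1, h2⟩ := h a b ha hb
  have hs : EqOn f' g' (uIcc a b) := hf'.mono (uIcc_subset_Ioi ha hb)
  refine ⟨h1.congr (hs.mono uIoc_subset_uIcc), ?_⟩
  rw [← hf ha, ← hf hb, h2, intervalIntegral.integral_congr hs]

theorem of_hasDerivAt (h : ∀ x, 0 < x → HasDerivAt f (f' x) x)
    (hc : ContinuousOn f' (Ioi 0)) : HasWeakDeriv f f' := by
  intro a b ha hb
  have hs := uIcc_subset_Ioi ha hb
  have hi : IntervalIntegrable f' volume a b := (hc.mono hs).intervalIntegrable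
  exact ⟨hi, (intervalIntegral.integral_eq_sub_of_hasDerivAt (fun x hx => h x (hs hx)) hi).symm⟩

theorem hasDerivAt (h : HasWeakDeriv f f') (hc : ContinuousOn f' (Ioi 0)) {x : ℝ} (hx : 0 < x) :
    HasDerivAt f (f' x) x := by
  have h1 : HasDerivAt (fun u => f x + ∫ y in x..u, f' y) (f' x) x :=
    (intervalIntegral.integral_hasDerivAt_right (h x x hx hx).1
      (hc.stronglyMeasurableAtFilter isOpen_Ioi x hx)
      (hc.continuousAt (Ioi_mem_nhds hx))).const_add _
  refine h1.congr_of_eventuallyEq ?_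
  filter_upwards [Ioi_mem_nhds hx] with y hy using h.eq_add hx hy

theorem absolutelyContinuous (h : HasWeakDeriv f f') {a b : ℝ} (ha : 0 < a) (hb : 0 < b) :
    AbsolutelyContinuousOnInterval (fun x => f a + ∫ y in a..x, f' y) a b := by
  have h1 := (h a b ha hb).1.absolutelyContinuousOnInterval_intervalIntegral (c := a)
    left_mem_uIcc
  have h2 : AbsolutelyContinuousOnInterval (fun _ : ℝ => f a) a b :=
    contDiffOn_const.absolutelyContinuousOnInterval
  exact h2.fun_add h1

theorem ae_hasDerivAt (h : HasWeakDeriv f f') {a b : ℝ} (ha : 0 < a) (hb : 0 < b) :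
    ∀ᵐ x, x ∈ uIcc a b → HasDerivAt (fun x => f a + ∫ y in a..x, f' y) (f' x) x := by
  filter_upwards [(h a b ha hb).1.ae_hasDerivAt_integral] with x hx hxs
  exact (hx hxs a left_mem_uIcc).const_add _

theorem continuousOn (h : HasWeakDeriv f f') : ContinuousOn f (Ioi 0) := by
  intro x hx
  have hx : 0 < x := hx
  have h1 := (h.absolutelyContinuous (a := x / 2) (b := 2 * x) (by positivity)
    (by positivity)).continuousOn
  rw [uIcc_of_le (by linarith)] at h1
  have h2 := h1.continuousAt (Icc_mem_nhds (show x / 2 < x by linarith) (by linarith))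
  refine (h2.congr ?_).continuousWithinAt
  filter_upwards [Ioi_mem_nhds hx] with y hy
  exact (h.eq_add (by positivity) hy).symm

theorem add (hf : HasWeakDeriv f f') (hg : HasWeakDeriv g g') :
    HasWeakDeriv (fun x => f x + g x) (fun x => f' x + g' x) := by
  intro a b ha hb
  obtain ⟨h1, h2⟩ := hf a b ha hb
  obtain ⟨h3, h4⟩ := hg a b ha hb
  refine ⟨h1.add h3, ?_⟩
  rw [intervalIntegral.integral_add h1 h3, ← h2, ← h4]; ring

theorem const_mul (c : ℝ) (hf : HasWeakDeriv f f') :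
    HasWeakDeriv (fun x => c * f x) (fun x => c * f' x) := by
  intro a b ha hb
  obtain ⟨h1, h2⟩ := hf a b ha hb
  refine ⟨h1.const_mul c, ?_⟩
  rw [intervalIntegral.integral_const_mul, ← h2]; ring

theorem sub (hf : HasWeakDeriv f f') (hg : HasWeakDeriv g g') :
    HasWeakDeriv (fun x => f x - g x) (fun x => f' x - g' x) :=
  (hf.add (hg.const_mul (-1))).congr (fun x _ => by ring) (fun x _ => by ring)

theorem const_add (c : ℝ) (hf : HasWeakDeriv f f') :
    HasWeakDeriv (fun x => c + f x) f' := by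
  intro a b ha hb
  obtain ⟨h1, h2⟩ := hf a b ha hb
  exact ⟨h1, by rw [← h2]; ring⟩

/-- The product rule. -/
theorem mul (hf : HasWeakDeriv f f') (hg : HasWeakDeriv g g') :
    HasWeakDeriv (fun x => f x * g x) (fun x => f' x * g x + f x * g' x) := by
  intro a b ha hb
  have hs := uIcc_subset_Ioi ha hb
  refine ⟨((hf a b ha hb).1.mul_continuousOn (hg.continuousOn.mono hs)).add
    ((hg a b ha hb).1.continuousOn_mul (hf.continuousOn.mono hs)), ?_⟩
  have h := AbsolutelyContinuousOnInterval.integral_deriv_mul_eq_sub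
    (hf.absolutelyContinuous ha hb) (hg.absolutelyContinuous ha hb)
  rw [← hf.eq_add ha hb, ← hg.eq_add ha hb, ← hf.eq_add ha ha, ← hg.eq_add ha ha] at h
  rw [← h]
  apply intervalIntegral.integral_congr_ae
  filter_upwards [hf.ae_hasDerivAt ha hb, hg.ae_hasDerivAt ha hb] with x h1 h2 hx
  have hxI := uIoc_subset_uIcc hx
  rw [(h1 hxI).deriv, (h2 hxI).deriv, ← hf.eq_add ha (hs hxI), ← hg.eq_add ha (hs hxI)]

/-- The chain rule for the exponential function. -/
theorem exp (hf : HasWeakDeriv f f') :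
    HasWeakDeriv (fun x => Real.exp (f x)) (fun x => f' x * Real.exp (f x)) := by
  intro a b ha hb
  have hs := uIcc_subset_Ioi ha hb
  refine ⟨(hf a b ha hb).1.mul_continuousOn (hf.continuousOn.mono hs).rexp, ?_⟩
  obtain ⟨c, hc⟩ := (hf.absolutelyContinuous ha hb).exists_bound
  obtain ⟨K, hK⟩ := (Real.contDiff_exp (n := 1)).contDiffOn.exists_lipschitzOnWith (by decide)
    (convex_Icc (-c) c) isCompact_Icc
  have hac := absolutelyContinuousOnInterval_lipschitz_comp hK (hf.absolutelyContinuous ha hb)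
    (fun x hx => abs_le.1 (hc x hx))
  have h := hac.integral_deriv_eq_sub
  rw [← hf.eq_add ha hb, ← hf.eq_add ha ha] at h
  rw [← h]
  apply intervalIntegral.integral_congr_ae
  filter_upwards [hf.ae_hasDerivAt ha hb] with x h1 hx
  have hx' := uIoc_subset_uIcc hx
  rw [(h1 hx').exp.deriv, ← hf.eq_add ha (hs hx'), mul_comm]

theorem eq_of_deriv_zero (hf : HasWeakDeriv f fun _ => 0) {x y : ℝ} (hx : 0 < x) (hy : 0 < y) :
    f x = f y := by
  have := (hf y x hy hx).2
  simp at this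
  linarith

end HasWeakDeriv

/-! ### Primitives -/

theorem hasWeakDeriv_integral_Ioc {b : ℝ → ℝ} (hb : ∀ x, 0 < x → IntegrableOn b (Ioc 0 x)) :
    HasWeakDeriv (fun x => ∫ y in Ioc 0 x, b y) b := by
  have hi : ∀ x : ℝ, 0 < x → IntervalIntegrable b volume 0 x := fun x hx =>
    (intervalIntegrable_iff_integrableOn_Ioc_of_le hx.le).2 (hb x hx)
  intro x y hx hy
  refine ⟨(hi x hx).symm.trans (hi y hy), ?_⟩
  beta_reduce
  rw [← intervalIntegral.integral_of_le hx.le, ← intervalIntegral.integral_of_le hy.le,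
    intervalIntegral.integral_interval_sub_left (hi y hy) (hi x hx)]

theorem hasWeakDeriv_integral_Ioi {b : ℝ → ℝ} (hb : ∀ x, 0 < x → IntegrableOn b (Ioi x)) :
    HasWeakDeriv (fun x => ∫ y in Ioi x, b y) (fun x => -b x) := by
  intro x y hx hy
  have hi : IntervalIntegrable b volume x y := by
    rw [intervalIntegrable_iff]
    exact (hb (min x y) (lt_min hx hy)).mono_set fun t ht => ht.1
  refine ⟨hi.neg, ?_⟩
  rw [intervalIntegral.integral_neg, ← intervalIntegral.integral_Ioi_sub_Ioi' (hb x hx) (hb y hy)]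
  ring

theorem tendsto_integral_Ioc_zero {b : ℝ → ℝ} {X : ℝ} (hX : 0 < X) (hb : IntegrableOn b (Ioc 0 X)) :
    Tendsto (fun x => ∫ y in Ioc 0 x, b y) (𝓝[>] 0) (𝓝 0) := by
  have h := intervalIntegral.continuousOn_primitive_interval
    (μ := volume) (f := b) (a := 0) (b := X) (by
      rw [uIcc_of_le hX.le]
      exact (integrableOn_Icc_iff_integrableOn_Ioc (by simp)).2 hb)
  have h2 := (h 0 left_mem_uIcc).tendsto
  rw [intervalIntegral.integral_same, uIcc_of_le hX.le] at h2
  have h3 : 𝓝[>] (0 : ℝ) ≤ 𝓝[Icc 0 X] 0 :=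
    nhdsWithin_le_of_mem (mem_of_superset (Ioc_mem_nhdsGT hX) Ioc_subset_Icc_self)
  refine (h2.mono_left h3).congr' ?_
  filter_upwards [self_mem_nhdsWithin] with x hx
  exact intervalIntegral.integral_of_le (le_of_lt hx)

theorem tendsto_integral_Ioi_atTop {b : ℝ → ℝ} {a : ℝ} (hb : IntegrableOn b (Ioi a)) :
    Tendsto (fun x => ∫ y in Ioi x, b y) atTop (𝓝 0) := by
  have h := (tendsto_const_nhds (x := ∫ y in Ioi a, b y)).sub
    (intervalIntegral_tendsto_integral_Ioi a hb tendsto_id)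
  rw [sub_self] at h
  refine h.congr' ?_
  filter_upwards [eventually_ge_atTop a] with x hx
  rw [id, ← intervalIntegral.integral_Ioi_sub_Ioi' hb (hb.mono_set (Ioi_subset_Ioi hx))]
  simp

/-! ### Exponential weights -/

/-- If `κ ≥ 0` is integrable near `0`, then `w(x) = exp (2 ∫₀ˣ κ)` satisfies
`∫₀ˣ κ w ≤ w(x)/2`. -/
theorem integral_Ioc_mul_exp_le {κ : ℝ → ℝ} (hκ : ∀ x, 0 < x → IntegrableOn κ (Ioc 0 x))
    (h0 : ∀ x, 0 < x → 0 ≤ κ x) {x : ℝ} (hx : 0 < x) :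
    IntegrableOn (fun y => κ y * Real.exp (2 * ∫ t in Ioc 0 y, κ t)) (Ioc 0 x) ∧
    ∫ y in Ioc 0 x, κ y * Real.exp (2 * ∫ t in Ioc 0 y, κ t)
      ≤ Real.exp (2 * ∫ t in Ioc 0 x, κ t) / 2 := by
  have hK := hasWeakDeriv_integral_Ioc hκ
  have hE := (hK.const_mul 2).exp
  have hi : ∀ x, 0 < x →
      IntegrableOn (fun y => κ y * Real.exp (2 * ∫ t in Ioc 0 y, κ t)) (Ioc 0 x) := by
    intro x hx
    refine ((hκ x hx).bdd_mul (c := Real.exp (2 * ∫ t in Ioc 0 x, κ t)) (f :=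
      fun y => Real.exp (2 * ∫ t in Ioc 0 y, κ t)) ?_ ?_).congr (ae_of_all _ fun y => mul_comm _ _)
    · exact (hE.continuousOn.mono fun y hy => hy.1).aestronglyMeasurable measurableSet_Ioc
    · refine (ae_restrict_iff' measurableSet_Ioc).2 (ae_of_all _ fun y hy => ?_)
      rw [Real.norm_eq_abs, Real.abs_exp, Real.exp_le_exp]
      refine mul_le_mul_of_nonneg_left ?_ zero_le_two
      exact setIntegral_mono_set (hκ x hx)
        ((ae_restrict_iff' measurableSet_Ioc).2 (ae_of_all _ fun t ht => h0 t ht.1))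
        (Ioc_subset_Ioc_right hy.2).eventuallyLE
  refine ⟨hi x hx, ?_⟩
  have hD : HasWeakDeriv (fun x => (∫ y in Ioc 0 x, κ y * Real.exp (2 * ∫ t in Ioc 0 y, κ t))
      - 1 / 2 * Real.exp (2 * ∫ t in Ioc 0 x, κ t)) (fun _ => 0) :=
    ((hasWeakDeriv_integral_Ioc hi).sub (hE.const_mul (1 / 2))).congr (fun _ _ => rfl)
      (fun y _ => by ring)
  have hlim : Tendsto (fun x => (∫ y in Ioc 0 x, κ y * Real.exp (2 * ∫ t in Ioc 0 y, κ t))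
      - 1 / 2 * Real.exp (2 * ∫ t in Ioc 0 x, κ t)) (𝓝[>] 0)
      (𝓝 (0 - 1 / 2 * Real.exp (2 * 0))) :=
    (tendsto_integral_Ioc_zero hx (hi x hx)).sub
      (((tendsto_integral_Ioc_zero hx (hκ x hx)).const_mul 2).rexp.const_mul _)
  have hc := tendsto_nhds_unique (hlim.congr' (f₂ := fun _ =>
    (∫ y in Ioc 0 x, κ y * Real.exp (2 * ∫ t in Ioc 0 y, κ t))
      - 1 / 2 * Real.exp (2 * ∫ t in Ioc 0 x, κ t)) (by
      filter_upwards [self_mem_nhdsWithin] with y hy using hD.eq_of_deriv_zero hy hx))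
      tendsto_const_nhds
  simp at hc
  linarith

/-- If `κ ≥ 0` is integrable near `∞`, then `w(x) = exp (2 ∫ₓ^∞ κ)` satisfies
`∫ₓ^∞ κ w ≤ w(x)/2`. -/
theorem integral_Ioi_mul_exp_le {κ : ℝ → ℝ} (hκ : ∀ x, 0 < x → IntegrableOn κ (Ioi x))
    (h0 : ∀ x, 0 < x → 0 ≤ κ x) {x : ℝ} (hx : 0 < x) :
    IntegrableOn (fun y => κ y * Real.exp (2 * ∫ t in Ioi y, κ t)) (Ioi x) ∧
    ∫ y in Ioi x, κ y * Real.exp (2 * ∫ t in Ioi y, κ t)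
      ≤ Real.exp (2 * ∫ t in Ioi x, κ t) / 2 := by
  have hK := hasWeakDeriv_integral_Ioi hκ
  have hE := (hK.const_mul 2).exp
  have hi : ∀ x, 0 < x →
      IntegrableOn (fun y => κ y * Real.exp (2 * ∫ t in Ioi y, κ t)) (Ioi x) := by
    intro x hx
    refine ((hκ x hx).bdd_mul (c := Real.exp (2 * ∫ t in Ioi x, κ t)) (f :=
      fun y => Real.exp (2 * ∫ t in Ioi y, κ t)) ?_ ?_).congr (ae_of_all _ fun y => mul_comm _ _)
    · exact (hE.continuousOn.mono fun y hy => hx.trans hy).aestronglyMeasurable measurableSet_Ioi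
    · refine (ae_restrict_iff' measurableSet_Ioi).2 (ae_of_all _ fun y hy => ?_)
      rw [Real.norm_eq_abs, Real.abs_exp, Real.exp_le_exp]
      refine mul_le_mul_of_nonneg_left ?_ zero_le_two
      exact setIntegral_mono_set (hκ x hx)
        ((ae_restrict_iff' measurableSet_Ioi).2 (ae_of_all _ fun t ht => h0 t (hx.trans ht)))
        (Ioi_subset_Ioi (le_of_lt hy)).eventuallyLE
  refine ⟨hi x hx, ?_⟩
  have hD : HasWeakDeriv (fun x => (∫ y in Ioi x, κ y * Real.exp (2 * ∫ t in Ioi y, κ t))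
      - 1 / 2 * Real.exp (2 * ∫ t in Ioi x, κ t)) (fun _ => 0) :=
    ((hasWeakDeriv_integral_Ioi hi).sub (hE.const_mul (1 / 2))).congr (fun _ _ => rfl)
      (fun y _ => by ring)
  have hlim : Tendsto (fun x => (∫ y in Ioi x, κ y * Real.exp (2 * ∫ t in Ioi y, κ t))
      - 1 / 2 * Real.exp (2 * ∫ t in Ioi x, κ t)) atTop
      (𝓝 (0 - 1 / 2 * Real.exp (2 * 0))) :=
    (tendsto_integral_Ioi_atTop (hi x hx)).sub
      (((tendsto_integral_Ioi_atTop (hκ x hx)).const_mul 2).rexp.const_mul _)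
  have hc := tendsto_nhds_unique (hlim.congr' (f₂ := fun _ =>
    (∫ y in Ioi x, κ y * Real.exp (2 * ∫ t in Ioi y, κ t))
      - 1 / 2 * Real.exp (2 * ∫ t in Ioi x, κ t)) (by
      filter_upwards [eventually_gt_atTop 0] with y hy using hD.eq_of_deriv_zero hy hx))
      tendsto_const_nhds
  simp at hc
  linarith

/-! ### Gronwall's inequality and Volterra equations -/

/-- An abstract Gronwall inequality: the sets `D x` are the domains of integration and `w` is a
weight with `∫_{D x} κ w ≤ w(x)/2`. -/
theorem le_two_mul_weight {S : Set ℝ} {D : ℝ → Set ℝ} {κ θ w : ℝ → ℝ} {a M : ℝ}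
    (hD : ∀ x ∈ S, D x ⊆ S) (hDm : ∀ x, MeasurableSet (D x)) (hw : ∀ x ∈ S, 1 ≤ w x)
    (hκ : ∀ x ∈ S, 0 ≤ κ x) (hi : ∀ x ∈ S, IntegrableOn (fun y => κ y * w y) (D x))
    (hle : ∀ x ∈ S, ∫ y in D x, κ y * w y ≤ w x / 2)
    (ha : 0 ≤ a) (hM : 0 ≤ M) (hθ0 : ∀ x ∈ S, 0 ≤ θ x) (hθM : ∀ x ∈ S, θ x ≤ M * w x)
    (hθ : ∀ x ∈ S, θ x ≤ a + ∫ y in D x, κ y * θ y) {x : ℝ} (hx : x ∈ S) :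
    θ x ≤ 2 * a * w x := by
  have hn : ∀ n : ℕ, ∀ x ∈ S, θ x ≤ (2 * a + M * (1 / 2) ^ n) * w x := by
    intro n
    induction n with
    | zero =>
      intro x hx
      have := hθM x hx
      have h1 := mul_nonneg ha (zero_le_one.trans (hw x hx))
      simp only [pow_zero]
      nlinarith
    | succ n ih =>
      intro x hx
      set C := 2 * a + M * (1 / 2) ^ n with hC
      have hC0 : 0 ≤ C := by positivity
      have h1 : ∫ y in D x, κ y * θ y ≤ ∫ y in D x, C * (κ y * w y) := by
        refine integral_mono_of_nonneg ?_ ((hi x hx).const_mul C) ?_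
        · refine (ae_restrict_iff' (hDm x)).2 (ae_of_all _ fun y hy => ?_)
          exact mul_nonneg (hκ y (hD x hx hy)) (hθ0 y (hD x hx hy))
        · refine (ae_restrict_iff' (hDm x)).2 (ae_of_all _ fun y hy => ?_)
          have := mul_le_mul_of_nonneg_left (ih y (hD x hx hy)) (hκ y (hD x hx hy))
          calc κ y * θ y ≤ κ y * (C * w y) := this
            _ = C * (κ y * w y) := by ring
      rw [integral_const_mul] at h1
      have h2 := mul_le_mul_of_nonneg_left (hle x hx) hC0
      have h3 := hθ x hx
      have h4 := mul_le_mul_of_nonneg_left (hw x hx) ha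
      have h5 : (2 * a + M * (1 / 2) ^ (n + 1)) * w x = a * w x + C * (w x / 2) := by
        rw [hC, pow_succ]; ring
      rw [h5]
      linarith
  have hlim : Tendsto (fun n : ℕ => (2 * a + M * (1 / 2) ^ n) * w x) atTop
      (𝓝 ((2 * a + M * 0) * w x)) :=
    (((tendsto_pow_atTop_nhds_zero_of_lt_one (by norm_num) (by norm_num)).const_mul M).const_add
      _).mul_const _
  have := ge_of_tendsto' hlim fun n => hn n x hx
  simpa using this

/-- Gronwall's inequality on `(0, X]`. -/
theorem gronwall_Ioc {κ θ : ℝ → ℝ} {a M X : ℝ} (hκ : ∀ x, 0 < x → IntegrableOn κ (Ioc 0 x))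
    (h0 : ∀ x, 0 < x → 0 ≤ κ x) (ha : 0 ≤ a) (hθ0 : ∀ x ∈ Ioc 0 X, 0 ≤ θ x)
    (hθM : ∀ x ∈ Ioc 0 X, θ x ≤ M)
    (hθ : ∀ x ∈ Ioc 0 X, θ x ≤ a + ∫ y in Ioc 0 x, κ y * θ y) {x : ℝ} (hx : x ∈ Ioc 0 X) :
    θ x ≤ 2 * a * Real.exp (2 * ∫ y in Ioc 0 x, κ y) := by
  have hw : ∀ x ∈ Ioc 0 X, 1 ≤ Real.exp (2 * ∫ y in Ioc 0 x, κ y) := fun x _ =>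
    Real.one_le_exp (mul_nonneg zero_le_two
      (setIntegral_nonneg measurableSet_Ioc fun y hy => h0 y hy.1))
  have hM : 0 ≤ M := (hθ0 x hx).trans (hθM x hx)
  refine le_two_mul_weight (S := Ioc 0 X) (D := fun x => Ioc 0 x) (κ := κ)
    (w := fun x => Real.exp (2 * ∫ y in Ioc 0 x, κ y)) (M := M)
    (fun x hx => Ioc_subset_Ioc_right hx.2) (fun _ => measurableSet_Ioc) hw
    (fun x hx => h0 x hx.1) (fun x hx => (integral_Ioc_mul_exp_le hκ h0 hx.1).1)
    (fun x hx => (integral_Ioc_mul_exp_le hκ h0 hx.1).2) ha hM hθ0 ?_ hθ hx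
  intro x hx
  exact (hθM x hx).trans (le_mul_of_one_le_right hM (hw x hx))

/-- Gronwall's inequality on `[c, b]`, integrating from the right end point. -/
theorem gronwall_Icc {κ θ : ℝ → ℝ} {a M b c : ℝ} (hc : 0 < c) (hκ : IntegrableOn κ (Ioc c b))
    (h0 : ∀ x, 0 ≤ κ x) (ha : 0 ≤ a) (hθ0 : ∀ x ∈ Icc c b, 0 ≤ θ x)
    (hθM : ∀ x ∈ Icc c b, θ x ≤ M)
    (hθ : ∀ x ∈ Icc c b, θ x ≤ a + ∫ y in Ioc x b, κ y * θ y) {x : ℝ} (hx : x ∈ Icc c b) :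
    θ x ≤ 2 * a * Real.exp (2 * ∫ y in Ioc x b, κ y) := by
  set κ' : ℝ → ℝ := (Ioc c b).indicator κ with hκ'
  have h0' : ∀ x, 0 < x → 0 ≤ κ' x := fun x _ => indicator_nonneg (fun y _ => h0 y) x
  have hi' : ∀ x, 0 < x → IntegrableOn κ' (Ioi x) := fun x _ =>
    (hκ.integrable_indicator measurableSet_Ioc).integrableOn
  have hK : ∀ x ∈ Icc c b, ∫ y in Ioi x, κ' y = ∫ y in Ioc x b, κ y := by
    intro x hx
    rw [hκ', setIntegral_indicator measurableSet_Ioc]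
    congr 2
    ext y
    simp only [mem_inter_iff, mem_Ioi, mem_Ioc]
    exact ⟨fun h => ⟨h.1, h.2.2⟩, fun h => ⟨h.1, lt_of_le_of_lt hx.1 h.1, h.2⟩⟩
  have hw : ∀ x ∈ Icc c b, 1 ≤ Real.exp (2 * ∫ y in Ioi x, κ' y) := fun x hx =>
    Real.one_le_exp (mul_nonneg zero_le_two
      (setIntegral_nonneg measurableSet_Ioi fun y hy => h0' y ((hc.trans_le hx.1).trans hy)))
  have hM : 0 ≤ M := (hθ0 x hx).trans (hθM x hx)
  have hsub : ∀ x, Ioc x b ⊆ Ioi x := fun x y hy => hy.1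
  rw [← hK x hx]
  refine le_two_mul_weight (S := Icc c b) (D := fun x => Ioc x b) (κ := κ')
    (w := fun x => Real.exp (2 * ∫ y in Ioi x, κ' y)) (M := M)
    (fun x hx y hy => ⟨hx.1.trans hy.1.le, hy.2⟩) (fun _ => measurableSet_Ioc) hw
    (fun x hx => h0' x (hc.trans_le hx.1))
    (fun x hx => (integral_Ioi_mul_exp_le hi' h0' (hc.trans_le hx.1)).1.mono_set (hsub x))
    (fun x hx => ?_) ha hM hθ0 ?_ ?_ hx
  · have hx0 := hc.trans_le hx.1
    refine le_trans ?_ (integral_Ioi_mul_exp_le hi' h0' hx0).2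
    refine setIntegral_mono_set (integral_Ioi_mul_exp_le hi' h0' hx0).1 ?_
      (hsub x).eventuallyLE
    refine (ae_restrict_iff' measurableSet_Ioi).2 (ae_of_all _ fun y hy => ?_)
    exact mul_nonneg (h0' y (hx0.trans hy)) (Real.exp_nonneg _)
  · intro x hx
    exact (hθM x hx).trans (le_mul_of_one_le_right hM (hw x hx))
  · intro x hx
    refine (hθ x hx).trans_eq ?_
    congr 1
    refine setIntegral_congr_fun measurableSet_Ioc fun y hy => ?_
    simp only [hκ', indicator_of_mem (show y ∈ Ioc c b from ⟨lt_of_le_of_lt hx.1 hy.1, hy.2⟩)]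

/-- Solvability of Volterra integral equations on `(0,∞)` with a kernel
`a₁(x) b₁(y) + a₂(x) b₂(y)`. -/
theorem exists_volterra_solution {D : ℝ → Set ℝ} {κ w u₀ a₁ a₂ b₁ b₂ : ℝ → ℝ}
    (hD : ∀ x, 0 < x → D x ⊆ Ioi 0) (hDm : ∀ x, MeasurableSet (D x))
    (hprim : ∀ b : ℝ → ℝ, (∀ x, 0 < x → IntegrableOn b (D x)) →
      ContinuousOn (fun x => ∫ y in D x, b y) (Ioi 0))
    (hw : ∀ x, 0 < x → 1 ≤ w x) (hwc : ContinuousOn w (Ioi 0))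
    (hi : ∀ x, 0 < x → IntegrableOn (fun y => κ y * w y) (D x))
    (hle : ∀ x, 0 < x → ∫ y in D x, κ y * w y ≤ w x / 2)
    (hu₀ : ContinuousOn u₀ (Ioi 0)) (hu₀' : ∀ x, 0 < x → |u₀ x| ≤ 1)
    (ha₁ : ContinuousOn a₁ (Ioi 0)) (ha₂ : ContinuousOn a₂ (Ioi 0))
    (hb₁ : ∀ x, 0 < x → IntegrableOn (fun y => b₁ y * w y) (D x))
    (hb₂ : ∀ x, 0 < x → IntegrableOn (fun y => b₂ y * w y) (D x))
    (hker : ∀ x, 0 < x → ∀ y ∈ D x, |a₁ x * b₁ y + a₂ x * b₂ y| ≤ κ y) :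
    ∃ u : ℝ → ℝ, ContinuousOn u (Ioi 0) ∧ (∀ x, 0 < x → |u x| ≤ 2 * w x) ∧
      (∀ x, 0 < x → IntegrableOn (fun y => b₁ y * u y) (D x)) ∧
      (∀ x, 0 < x → IntegrableOn (fun y => b₂ y * u y) (D x)) ∧
      ∀ x, 0 < x → u x = u₀ x + a₁ x * (∫ y in D x, b₁ y * u y)
        + a₂ x * ∫ y in D x, b₂ y * u y := by
  have hw0 : ∀ x, 0 < x → 0 < w x := fun x hx => zero_lt_one.trans_le (hw x hx)
  have hInt : ∀ {b g : ℝ → ℝ} {M : ℝ}, (∀ x, 0 < x → IntegrableOn (fun y => b y * w y) (D x)) →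
      ContinuousOn g (Ioi 0) → (∀ x, 0 < x → |g x| ≤ M) →
      ∀ x, 0 < x → IntegrableOn (fun y => b y * (w y * g y)) (D x) := by
    intro b g M hb hg hM x hx
    refine ((hb x hx).bdd_mul (c := M) (f := g) ?_ ?_).congr (ae_of_all _ fun y => ?_)
    · exact (hg.mono (hD x hx)).aestronglyMeasurable (hDm x)
    · exact (ae_restrict_iff' (hDm x)).2 (ae_of_all _ fun y hy => hM y (hD x hx hy))
    · ring
  let L : (ℝ → ℝ) → ℝ → ℝ := fun g x => a₁ x * (∫ y in D x, b₁ y * (w y * g y))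
    + a₂ x * ∫ y in D x, b₂ y * (w y * g y)
  have hLc : ∀ {g : ℝ → ℝ} {M : ℝ}, ContinuousOn g (Ioi 0) → (∀ x, 0 < x → |g x| ≤ M) →
      ContinuousOn (L g) (Ioi 0) := fun hg hM =>
    (ha₁.mul (hprim _ (hInt hb₁ hg hM))).add (ha₂.mul (hprim _ (hInt hb₂ hg hM)))
  have hLb : ∀ {g : ℝ → ℝ} {M : ℝ}, ContinuousOn g (Ioi 0) → (∀ x, 0 < x → |g x| ≤ M) → 0 ≤ M →
      ∀ x, 0 < x → |L g x| ≤ M / 2 * w x := by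
    intro g M hg hM hM0 x hx
    have h1 : L g x = ∫ y in D x, (a₁ x * b₁ y + a₂ x * b₂ y) * (w y * g y) := by
      simp only [L]
      rw [← integral_const_mul, ← integral_const_mul, ← integral_add
        ((hInt hb₁ hg hM x hx).const_mul _) ((hInt hb₂ hg hM x hx).const_mul _)]
      exact integral_congr_ae (ae_of_all _ fun y => by ring)
    rw [h1, ← Real.norm_eq_abs]
    have h2 : ∫ y in D x, M * (κ y * w y) ≤ M / 2 * w x := by
      rw [integral_const_mul]
      have := mul_le_mul_of_nonneg_left (hle x hx) hM0
      linarith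
    refine (norm_integral_le_of_norm_le ((hi x hx).const_mul M) ?_).trans h2
    refine (ae_restrict_iff' (hDm x)).2 (ae_of_all _ fun y hy => ?_)
    have hy0 := hD x hx hy
    rw [Real.norm_eq_abs, abs_mul, abs_mul, abs_of_pos (hw0 y hy0)]
    calc |a₁ x * b₁ y + a₂ x * b₂ y| * (w y * |g y|)
        ≤ κ y * (w y * M) := mul_le_mul (hker x hx y hy)
          (mul_le_mul_of_nonneg_left (hM y hy0) (hw0 y hy0).le)
          (mul_nonneg (hw0 y hy0).le (abs_nonneg _)) ((abs_nonneg _).trans (hker x hx y hy))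
      _ = M * (κ y * w y) := by ring
  let ext : BoundedContinuousFunction (Ioi (0 : ℝ)) ℝ → ℝ → ℝ := fun g x =>
    if h : 0 < x then g ⟨x, h⟩ else 0
  have hext : ∀ (g : BoundedContinuousFunction (Ioi (0 : ℝ)) ℝ) (x : Ioi (0 : ℝ)),
      ext g x = g x := fun g x => dif_pos x.2
  have hextc : ∀ g, ContinuousOn (ext g) (Ioi 0) := by
    intro g
    rw [continuousOn_iff_continuous_domRestrict]
    exact g.continuous.congr fun x => (hext g x).symm
  have hextb : ∀ g, ∀ x, 0 < x → |ext g x| ≤ ‖g‖ := by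
    intro g x hx
    have := g.norm_coe_le_norm ⟨x, hx⟩
    rwa [← hext g ⟨x, hx⟩] at this
  have hTb : ∀ (g : BoundedContinuousFunction (Ioi (0 : ℝ)) ℝ) (x : Ioi (0 : ℝ)),
      ‖(u₀ x + L (ext g) x) / w x‖ ≤ 1 + ‖g‖ / 2 := by
    intro g x
    have hx := x.2
    rw [Real.norm_eq_abs, abs_div, abs_of_pos (hw0 x hx), div_le_iff₀ (hw0 x hx)]
    have h1 := hLb (hextc g) (hextb g) (norm_nonneg g) x hx
    have h2 := abs_add_le (u₀ x) (L (ext g) x)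
    have h3 := hu₀' x hx
    have h4 := hw x hx
    linarith
  let T : BoundedContinuousFunction (Ioi (0 : ℝ)) ℝ → BoundedContinuousFunction (Ioi (0 : ℝ)) ℝ :=
    fun g => BoundedContinuousFunction.ofNormedAddCommGroup
      (fun x => (u₀ x + L (ext g) x) / w x)
      (by
        have h : ContinuousOn (fun x => (u₀ x + L (ext g) x) / w x) (Ioi 0) :=
          (hu₀.add (hLc (hextc g) (hextb g))).div hwc fun x hx => (hw0 x hx).ne'
        exact continuousOn_iff_continuous_domRestrict.1 h)
      (1 + ‖g‖ / 2) (hTb g)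
  have hLsub : ∀ g g' : BoundedContinuousFunction (Ioi (0 : ℝ)) ℝ, ∀ x, 0 < x →
      L (ext g) x - L (ext g') x = L (ext (g - g')) x := by
    intro g g' x hx
    have h1 : ∀ b : ℝ → ℝ, (∀ x, 0 < x → IntegrableOn (fun y => b y * w y) (D x)) →
        ∫ y in D x, b y * (w y * ext (g - g') y)
        = (∫ y in D x, b y * (w y * ext g y)) - ∫ y in D x, b y * (w y * ext g' y) := by
      intro b hb
      rw [← integral_sub (hInt hb (hextc g) (hextb g) x hx) (hInt hb (hextc g') (hextb g') x hx)]
      refine setIntegral_congr_fun (hDm x) fun y hy => ?_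
      have hy0 : 0 < y := hD x hx hy
      simp only [ext, dif_pos hy0, BoundedContinuousFunction.coe_sub, Pi.sub_apply]
      ring
    simp only [L]
    rw [h1 b₁ hb₁, h1 b₂ hb₂]
    ring
  have hT : ContractingWith (1 / 2) T := by
    refine ⟨by norm_num, LipschitzWith.of_dist_le_mul fun g g' => ?_⟩
    rw [BoundedContinuousFunction.dist_le (by positivity)]
    intro x
    have hx := x.2
    change dist ((u₀ x + L (ext g) x) / w x) ((u₀ x + L (ext g') x) / w x) ≤ _
    rw [Real.dist_eq, ← sub_div, add_sub_add_left_eq_sub, hLsub g g' x hx, abs_div,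
      abs_of_pos (hw0 x hx), div_le_iff₀ (hw0 x hx), dist_eq_norm]
    refine (hLb (hextc (g - g')) (hextb (g - g')) (norm_nonneg _) x hx).trans_eq ?_
    push_cast
    ring
  obtain ⟨g, hg⟩ : ∃ g, T g = g := ⟨_, hT.fixedPoint_isFixedPt⟩
  have hgx : ∀ x, 0 < x → w x * ext g x = u₀ x + L (ext g) x := by
    intro x hx
    have h1 : (u₀ x + L (ext g) x) / w x = g ⟨x, hx⟩ := by
      conv_rhs => rw [← hg]
      rfl
    rw [← hext g ⟨x, hx⟩] at h1
    rw [← h1, mul_div_cancel₀ _ (hw0 x hx).ne']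
  have hgn : ‖g‖ ≤ 2 := by
    have h1 : ‖T g‖ ≤ 1 + ‖g‖ / 2 :=
      BoundedContinuousFunction.norm_ofNormedAddCommGroup_le _ (by positivity) (hTb g)
    rw [hg] at h1
    linarith
  refine ⟨fun x => w x * ext g x, hwc.mul (hextc g), fun x hx => ?_,
    hInt hb₁ (hextc g) (hextb g), hInt hb₂ (hextc g) (hextb g), fun x hx => ?_⟩
  · rw [abs_mul, abs_of_pos (hw0 x hx), mul_comm]
    exact mul_le_mul_of_nonneg_right ((hextb g x hx).trans hgn) (hw0 x hx).le
  · exact (hgx x hx).trans (add_assoc _ _ _).symm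

theorem integrableOn_mul_of_bdd {S : Set ℝ} (hS : MeasurableSet S) (hS0 : S ⊆ Ioi 0)
    {f g : ℝ → ℝ} {c : ℝ} (hf : IntegrableOn f S) (hg : ContinuousOn g (Ioi 0))
    (hc : ∀ x ∈ S, |g x| ≤ c) : IntegrableOn (fun x => f x * g x) S :=
  ((hf.bdd_mul (c := c) (f := g) ((hg.mono hS0).aestronglyMeasurable hS)
    ((ae_restrict_iff' hS).2 (ae_of_all _ hc)))).congr (ae_of_all _ fun _ => mul_comm _ _)

theorem Ioc_zero_subset {x : ℝ} : Ioc 0 x ⊆ Ioi 0 := fun _ hy => hy.1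

theorem Ioi_subset_Ioi_zero {x : ℝ} (hx : 0 < x) : Ioi x ⊆ Ioi 0 := fun _ hy => hx.trans hy

/-- Solvability of Volterra equations with integration over `(0, x]`. -/
theorem exists_volterra_solution_Ioc {κ u₀ a₁ a₂ b₁ b₂ : ℝ → ℝ}
    (hκ : ∀ x, 0 < x → IntegrableOn κ (Ioc 0 x)) (h0 : ∀ x, 0 < x → 0 ≤ κ x)
    (hu₀ : ContinuousOn u₀ (Ioi 0)) (hu₀' : ∀ x, 0 < x → |u₀ x| ≤ 1)
    (ha₁ : ContinuousOn a₁ (Ioi 0)) (ha₂ : ContinuousOn a₂ (Ioi 0))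
    (hb₁ : ∀ x, 0 < x → IntegrableOn b₁ (Ioc 0 x))
    (hb₂ : ∀ x, 0 < x → IntegrableOn b₂ (Ioc 0 x))
    (hker : ∀ x, 0 < x → ∀ y ∈ Ioc 0 x, |a₁ x * b₁ y + a₂ x * b₂ y| ≤ κ y) :
    ∃ u : ℝ → ℝ, ContinuousOn u (Ioi 0) ∧
      (∀ x, 0 < x → |u x| ≤ 2 * Real.exp (2 * ∫ y in Ioc 0 x, κ y)) ∧
      (∀ x, 0 < x → IntegrableOn (fun y => b₁ y * u y) (Ioc 0 x)) ∧
      (∀ x, 0 < x → IntegrableOn (fun y => b₂ y * u y) (Ioc 0 x)) ∧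
      ∀ x, 0 < x → u x = u₀ x + a₁ x * (∫ y in Ioc 0 x, b₁ y * u y)
        + a₂ x * ∫ y in Ioc 0 x, b₂ y * u y := by
  have hwc : ContinuousOn (fun x => Real.exp (2 * ∫ y in Ioc 0 x, κ y)) (Ioi 0) :=
    ((hasWeakDeriv_integral_Ioc hκ).const_mul 2).exp.continuousOn
  have hwb : ∀ x, 0 < x → ∀ y ∈ Ioc 0 x, |Real.exp (2 * ∫ t in Ioc 0 y, κ t)|
      ≤ Real.exp (2 * ∫ t in Ioc 0 x, κ t) := by
    intro x hx y hy
    rw [Real.abs_exp, Real.exp_le_exp]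
    refine mul_le_mul_of_nonneg_left ?_ zero_le_two
    exact setIntegral_mono_set (hκ x hx)
      ((ae_restrict_iff' measurableSet_Ioc).2 (ae_of_all _ fun t ht => h0 t ht.1))
      (Ioc_subset_Ioc_right hy.2).eventuallyLE
  exact exists_volterra_solution (fun x _ => Ioc_zero_subset) (fun _ => measurableSet_Ioc)
    (fun b hb => (hasWeakDeriv_integral_Ioc hb).continuousOn)
    (fun x _ => Real.one_le_exp (mul_nonneg zero_le_two
      (setIntegral_nonneg measurableSet_Ioc fun y hy => h0 y hy.1))) hwc
    (fun x hx => (integral_Ioc_mul_exp_le hκ h0 hx).1)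
    (fun x hx => (integral_Ioc_mul_exp_le hκ h0 hx).2) hu₀ hu₀' ha₁ ha₂
    (fun x hx => integrableOn_mul_of_bdd measurableSet_Ioc Ioc_zero_subset (hb₁ x hx) hwc
      (hwb x hx))
    (fun x hx => integrableOn_mul_of_bdd measurableSet_Ioc Ioc_zero_subset (hb₂ x hx) hwc
      (hwb x hx)) hker

/-- Solvability of Volterra equations with integration over `(x, ∞)`. -/
theorem exists_volterra_solution_Ioi {κ u₀ a₁ a₂ b₁ b₂ : ℝ → ℝ}
    (hκ : ∀ x, 0 < x → IntegrableOn κ (Ioi x)) (h0 : ∀ x, 0 < x → 0 ≤ κ x)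
    (hu₀ : ContinuousOn u₀ (Ioi 0)) (hu₀' : ∀ x, 0 < x → |u₀ x| ≤ 1)
    (ha₁ : ContinuousOn a₁ (Ioi 0)) (ha₂ : ContinuousOn a₂ (Ioi 0))
    (hb₁ : ∀ x, 0 < x → IntegrableOn b₁ (Ioi x))
    (hb₂ : ∀ x, 0 < x → IntegrableOn b₂ (Ioi x))
    (hker : ∀ x, 0 < x → ∀ y ∈ Ioi x, |a₁ x * b₁ y + a₂ x * b₂ y| ≤ κ y) :
    ∃ u : ℝ → ℝ, ContinuousOn u (Ioi 0) ∧
      (∀ x, 0 < x → |u x| ≤ 2 * Real.exp (2 * ∫ y in Ioi x, κ y)) ∧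
      (∀ x, 0 < x → IntegrableOn (fun y => b₁ y * u y) (Ioi x)) ∧
      (∀ x, 0 < x → IntegrableOn (fun y => b₂ y * u y) (Ioi x)) ∧
      ∀ x, 0 < x → u x = u₀ x + a₁ x * (∫ y in Ioi x, b₁ y * u y)
        + a₂ x * ∫ y in Ioi x, b₂ y * u y := by
  have hwc : ContinuousOn (fun x => Real.exp (2 * ∫ y in Ioi x, κ y)) (Ioi 0) :=
    ((hasWeakDeriv_integral_Ioi hκ).const_mul 2).exp.continuousOn
  have hwb : ∀ x, 0 < x → ∀ y ∈ Ioi x, |Real.exp (2 * ∫ t in Ioi y, κ t)|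
      ≤ Real.exp (2 * ∫ t in Ioi x, κ t) := by
    intro x hx y hy
    rw [Real.abs_exp, Real.exp_le_exp]
    refine mul_le_mul_of_nonneg_left ?_ zero_le_two
    exact setIntegral_mono_set (hκ x hx)
      ((ae_restrict_iff' measurableSet_Ioi).2 (ae_of_all _ fun t ht => h0 t (hx.trans ht)))
      (Ioi_subset_Ioi (le_of_lt hy)).eventuallyLE
  exact exists_volterra_solution (fun x hx => Ioi_subset_Ioi_zero hx) (fun _ => measurableSet_Ioi)
    (fun b hb => (hasWeakDeriv_integral_Ioi hb).continuousOn)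
    (fun x hx => Real.one_le_exp (mul_nonneg zero_le_two
      (setIntegral_nonneg measurableSet_Ioi fun y hy => h0 y (hx.trans hy)))) hwc
    (fun x hx => (integral_Ioi_mul_exp_le hκ h0 hx).1)
    (fun x hx => (integral_Ioi_mul_exp_le hκ h0 hx).2) hu₀ hu₀' ha₁ ha₂
    (fun x hx => integrableOn_mul_of_bdd measurableSet_Ioi (Ioi_subset_Ioi_zero hx) (hb₁ x hx) hwc
      (hwb x hx))
    (fun x hx => integrableOn_mul_of_bdd measurableSet_Ioi (Ioi_subset_Ioi_zero hx) (hb₂ x hx) hwc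
      (hwb x hx)) hker

/-! ### Real solutions of `u'' = Q u` -/

/-- `u` is a real solution of `u'' = Q u` on `(0,∞)` with derivative `u'`. -/
structure IsRealSolution (Q u u' : ℝ → ℝ) : Prop where
  hasDerivAt : ∀ x, 0 < x → HasDerivAt u (u' x) x
  weak : HasWeakDeriv u' (fun x => Q x * u x)

namespace IsRealSolution

variable {Q Q₁ Q₂ u u' v v' : ℝ → ℝ}

theorem hasWeakDeriv (h : IsRealSolution Q u u') : HasWeakDeriv u u' :=
  .of_hasDerivAt h.hasDerivAt h.weak.continuousOn

theorem continuousOn (h : IsRealSolution Q u u') : ContinuousOn u (Ioi 0) :=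
  h.hasWeakDeriv.continuousOn

theorem of_hasDerivAt (h : ∀ x, 0 < x → HasDerivAt u (u' x) x)
    (h' : ∀ x, 0 < x → HasDerivAt u' (Q x * u x) x) (hQ : ContinuousOn Q (Ioi 0)) :
    IsRealSolution Q u u' :=
  ⟨h, .of_hasDerivAt h' (hQ.mul fun x hx => (h x hx).continuousAt.continuousWithinAt)⟩

theorem congr (h : IsRealSolution Q₁ u u') (hQ : EqOn Q₁ Q₂ (Ioi 0)) :
    IsRealSolution Q₂ u u' :=
  ⟨h.hasDerivAt, h.weak.congr (fun _ _ => rfl) fun x hx => by simp only [hQ hx]⟩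

theorem const_mul (c : ℝ) (h : IsRealSolution Q u u') :
    IsRealSolution Q (fun x => c * u x) (fun x => c * u' x) :=
  ⟨fun x hx => (h.hasDerivAt x hx).const_mul c,
    (h.weak.const_mul c).congr (fun _ _ => rfl) fun x _ => by ring⟩

/-- The derivative of the Wronskian of two solutions. -/
theorem wronskian (hu : IsRealSolution Q₁ u u') (hv : IsRealSolution Q₂ v v') :
    HasWeakDeriv (fun x => u x * v' x - u' x * v x)
      (fun x => (Q₂ x - Q₁ x) * (u x * v x)) :=
  ((hu.hasWeakDeriv.mul hv.weak).sub (hu.weak.mul hv.hasWeakDeriv)).congr (fun _ _ => rfl)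
    fun x _ => by ring

/-- Variation of parameters. -/
theorem of_variation {Q₀ R h₁ h₁' h₂ h₂' A A' B B' : ℝ → ℝ} (hh₁ : IsRealSolution Q₀ h₁ h₁')
    (hh₂ : IsRealSolution Q₀ h₂ h₂') (hA : HasWeakDeriv A A') (hB : HasWeakDeriv B B')
    (hu : ∀ x, 0 < x → u x = A x * h₁ x + B x * h₂ x)
    (e₁ : ∀ x, 0 < x → A' x * h₁ x + B' x * h₂ x = 0)
    (e₂ : ∀ x, 0 < x → A' x * h₁' x + B' x * h₂' x = R x * u x) :
    IsRealSolution (fun x => Q₀ x + R x) u (fun x => A x * h₁' x + B x * h₂' x) := by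
  have hw' := (hA.mul hh₁.weak).add (hB.mul hh₂.weak)
  have hw : HasWeakDeriv u (fun x => A x * h₁' x + B x * h₂' x) := by
    refine ((hA.mul hh₁.hasWeakDeriv).add (hB.mul hh₂.hasWeakDeriv)).congr
      (fun x hx => (hu x hx).symm) fun x hx => ?_
    have := e₁ x hx
    simp only
    linarith
  refine ⟨fun x hx => hw.hasDerivAt hw'.continuousOn hx, hw'.congr (fun _ _ => rfl) fun x hx => ?_⟩
  have h1 := e₂ x hx
  have h2 := hu x hx
  simp only
  calc _ = (A' x * h₁' x + B' x * h₂' x) + Q₀ x * (A x * h₁ x + B x * h₂ x) := by ring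
    _ = _ := by rw [h1, ← h2]; ring

/-- The growth of the energy `u'² + c² u²` of a solution. -/
theorem energy_le (hu : IsRealSolution Q u u')
    (hQ : ∀ a b, 0 < a → 0 < b → IntervalIntegrable Q volume a b) {c a b : ℝ} (hc : 0 < c)
    (ha : 0 < a) (hab : a ≤ b) :
    u' a ^ 2 + c ^ 2 * u a ^ 2 ≤
      2 * (u' b ^ 2 + c ^ 2 * u b ^ 2) * Real.exp (2 * ∫ y in Ioc a b, |Q y + c ^ 2| / c) := by
  have hE : HasWeakDeriv (fun x => u' x ^ 2 + c ^ 2 * u x ^ 2)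
      (fun x => (Q x + c ^ 2) * (2 * (u x * u' x))) :=
    ((hu.weak.mul hu.weak).add ((hu.hasWeakDeriv.mul hu.hasWeakDeriv).const_mul (c ^ 2))).congr
      (fun x _ => by ring) fun x _ => by ring
  have hcont : ContinuousOn (fun x => u' x ^ 2 + c ^ 2 * u x ^ 2) (Icc a b) :=
    hE.continuousOn.mono fun x hx => ha.trans_le hx.1
  obtain ⟨M, hM⟩ := isCompact_Icc.exists_bound_of_continuousOn hcont
  have hκi : ∀ x, 0 < x → x ≤ b → IntegrableOn (fun y => |Q y + c ^ 2| / c) (Ioc x b) := by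
    intro x hx hxb
    have h1 := ((hQ x b hx (hx.trans_le hxb)).add (intervalIntegrable_const (c := c ^ 2))).abs
    exact ((intervalIntegrable_iff_integrableOn_Ioc_of_le hxb).1 h1).div_const c
  refine gronwall_Icc (θ := fun x => u' x ^ 2 + c ^ 2 * u x ^ 2) (M := M) ha (hκi a ha hab)
    (fun x => by positivity) (by positivity) (fun x _ => by positivity)
    (fun x hx => (le_abs_self _).trans (hM x hx)) ?_ ⟨le_rfl, hab⟩
  intro x hx
  have hx0 := ha.trans_le hx.1
  obtain ⟨h1, h2⟩ := hE x b hx0 (hx0.trans_le hx.2)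
  have h3 : -∫ y in x..b, (Q y + c ^ 2) * (2 * (u y * u' y)) ≤
      ∫ y in Ioc x b, |Q y + c ^ 2| / c * (u' y ^ 2 + c ^ 2 * u y ^ 2) := by
    rw [← intervalIntegral.integral_neg, intervalIntegral.integral_of_le hx.2]
    have hs : Ioc x b ⊆ Ioi 0 := fun y hy => hx0.trans hy.1
    refine setIntegral_mono_on ((intervalIntegrable_iff_integrableOn_Ioc_of_le hx.2).1 h1).neg
      (integrableOn_mul_of_bdd measurableSet_Ioc hs (hκi x hx0 hx.2) hE.continuousOn
        (c := M) fun y hy => hM y ⟨hx.1.trans hy.1.le, hy.2⟩) measurableSet_Ioc fun y hy => ?_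
    refine (neg_le_abs _).trans ?_
    rw [abs_mul, div_mul_eq_mul_div, mul_div_assoc]
    refine mul_le_mul_of_nonneg_left ?_ (abs_nonneg _)
    rw [le_div_iff₀ hc, abs_mul, abs_two, abs_mul]
    have h4 := sq_nonneg (|u' y| - c * |u y|)
    have h5 := sq_abs (u y)
    have h6 := sq_abs (u' y)
    nlinarith
  simp only at h2
  linarith

end IsRealSolution

theorem continuousOn_rpow_Ioi (p : ℝ) : ContinuousOn (fun x : ℝ => x ^ p) (Ioi 0) := fun x hx =>
  (Real.continuousAt_rpow_const x p (Or.inl (ne_of_gt hx))).continuousWithinAt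

/-! ### The radial integral operator -/

/-- The solution `v` of `(x^{s+1} v')' = x^s b` with `v(0) = 0` and `x^{s+1} v' → 0`. -/
def radialPotential (s : ℝ) (b : ℝ → ℝ) (x : ℝ) : ℝ :=
  s⁻¹ * ((∫ y in Ioc 0 x, b y) - x ^ (-s) * ∫ y in Ioc 0 x, y ^ s * b y)

section radial

variable {s : ℝ} {b : ℝ → ℝ}

theorem integrableOn_rpow_mul (hs : 0 < s) {x : ℝ} (hb : IntegrableOn b (Ioc 0 x)) :
    IntegrableOn (fun y => y ^ s * b y) (Ioc 0 x) :=
  (integrableOn_mul_of_bdd measurableSet_Ioc Ioc_zero_subset hb (continuousOn_rpow_Ioi s)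
    (c := x ^ s) fun y hy => by
      rw [abs_of_nonneg (Real.rpow_nonneg hy.1.le s)]
      exact Real.rpow_le_rpow hy.1.le hy.2 hs.le).congr_fun (fun y _ => mul_comm _ _)
        measurableSet_Ioc

theorem rpow_neg_mul_rpow_le_one (hs : 0 < s) {x y : ℝ} (hy : y ∈ Ioc 0 x) :
    x ^ (-s) * y ^ s ≤ 1 := by
  have hx : 0 < x := hy.1.trans_le hy.2
  rw [Real.rpow_neg hx.le, inv_mul_le_one₀ (Real.rpow_pos_of_pos hx s)]
  exact Real.rpow_le_rpow hy.1.le hy.2 hs.le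

theorem rpow_neg_mul_rpow_nonneg {x y : ℝ} (hy : y ∈ Ioc 0 x) : 0 ≤ x ^ (-s) * y ^ s :=
  mul_nonneg (Real.rpow_nonneg (hy.1.trans_le hy.2).le _) (Real.rpow_nonneg hy.1.le _)

theorem abs_rpow_neg_mul_integral_le (hs : 0 < s) {x : ℝ} (hb : IntegrableOn b (Ioc 0 x)) :
    |x ^ (-s) * ∫ y in Ioc 0 x, y ^ s * b y| ≤ ∫ y in Ioc 0 x, |b y| := by
  rw [← integral_const_mul, ← Real.norm_eq_abs]
  refine norm_integral_le_of_norm_le hb.abs ?_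
  refine (ae_restrict_iff' measurableSet_Ioc).2 (ae_of_all _ fun y hy => ?_)
  rw [Real.norm_eq_abs, ← mul_assoc, abs_mul, abs_of_nonneg (rpow_neg_mul_rpow_nonneg hy)]
  exact mul_le_of_le_one_left (abs_nonneg _) (rpow_neg_mul_rpow_le_one hs hy)

theorem abs_radialPotential_le (hs : 0 < s) {x : ℝ} (hb : IntegrableOn b (Ioc 0 x)) :
    |radialPotential s b x| ≤ s⁻¹ * ∫ y in Ioc 0 x, |b y| := by
  rw [radialPotential, abs_mul, abs_of_pos (inv_pos.2 hs)]
  refine mul_le_mul_of_nonneg_left ?_ (inv_pos.2 hs).le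
  rw [← integral_const_mul, ← integral_sub hb ((integrableOn_rpow_mul hs hb).const_mul _),
    ← Real.norm_eq_abs]
  refine norm_integral_le_of_norm_le hb.abs ?_
  refine (ae_restrict_iff' measurableSet_Ioc).2 (ae_of_all _ fun y hy => ?_)
  have h1 : b y - x ^ (-s) * (y ^ s * b y) = (1 - x ^ (-s) * y ^ s) * b y := by ring
  have h2 := rpow_neg_mul_rpow_le_one hs hy
  have h3 := rpow_neg_mul_rpow_nonneg (s := s) hy
  rw [Real.norm_eq_abs, h1, abs_mul, abs_of_nonneg (by linarith)]
  exact mul_le_of_le_one_left (abs_nonneg _) (by linarith)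

theorem radialPotential_sub {b' : ℝ → ℝ} (hs : 0 < s) {x : ℝ} (hb : IntegrableOn b (Ioc 0 x))
    (hb' : IntegrableOn b' (Ioc 0 x)) :
    radialPotential s b x - radialPotential s b' x = radialPotential s (fun y => b y - b' y) x := by
  simp only [radialPotential, mul_sub (_ ^ s)]
  rw [integral_sub hb hb', integral_sub (integrableOn_rpow_mul hs hb) (integrableOn_rpow_mul hs hb')]
  ring

theorem hasWeakDeriv_rpow (p : ℝ) :
    HasWeakDeriv (fun x => x ^ p) (fun x => p * x ^ (p - 1)) :=
  .of_hasDerivAt (fun _ hx => Real.hasDerivAt_rpow_const (Or.inl hx.ne'))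
    (continuousOn_const.mul (continuousOn_rpow_Ioi _))

theorem hasDerivAt_radialPotential (hs : 0 < s) (hb : ∀ x, 0 < x → IntegrableOn b (Ioc 0 x))
    {x : ℝ} (hx : 0 < x) :
    HasDerivAt (radialPotential s b) (x ^ (-s - 1) * ∫ y in Ioc 0 x, y ^ s * b y) x := by
  have hB := hasWeakDeriv_integral_Ioc fun _ hx => integrableOn_rpow_mul hs (hb _ hx)
  have h : HasWeakDeriv (radialPotential s b)
      (fun x => x ^ (-s - 1) * ∫ y in Ioc 0 x, y ^ s * b y) := by
    refine (((hasWeakDeriv_integral_Ioc hb).sub ((hasWeakDeriv_rpow (-s)).mul hB)).const_mul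
      s⁻¹).congr (fun _ _ => rfl) fun x hx => ?_
    have hx : 0 < x := hx
    have h1 : x ^ (-s) * (x ^ s * b x) = b x := by
      rw [← mul_assoc, ← Real.rpow_add hx]; simp
    simp only [h1]
    field_simp
    ring
  exact h.hasDerivAt ((continuousOn_rpow_Ioi _).mul hB.continuousOn) hx

theorem tendsto_rpow_neg_mul_integral_zero (hs : 0 < s)
    (hb : ∀ x, 0 < x → IntegrableOn b (Ioc 0 x)) :
    Tendsto (fun x => x ^ (-s) * ∫ y in Ioc 0 x, y ^ s * b y) (𝓝[>] 0) (𝓝 0) := by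
  refine squeeze_zero_norm' ?_ (tendsto_integral_Ioc_zero one_pos (hb 1 one_pos).abs)
  filter_upwards [self_mem_nhdsWithin] with x hx
  exact abs_rpow_neg_mul_integral_le hs (hb x hx)

theorem tendsto_radialPotential_zero (hs : 0 < s) (hb : ∀ x, 0 < x → IntegrableOn b (Ioc 0 x)) :
    Tendsto (radialPotential s b) (𝓝[>] 0) (𝓝 0) := by
  have := ((tendsto_integral_Ioc_zero one_pos (hb 1 one_pos)).sub
    (tendsto_rpow_neg_mul_integral_zero hs hb)).const_mul s⁻¹
  rw [sub_zero, mul_zero] at this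
  exact this

theorem tendsto_rpow_neg_mul_integral_atTop (hs : 0 < s) (hb : IntegrableOn b (Ioi 0)) :
    Tendsto (fun x => x ^ (-s) * ∫ y in Ioc 0 x, y ^ s * b y) atTop (𝓝 0) := by
  have h : Tendsto (fun x => ∫ y in Ioi (0 : ℝ),
      (Ioc 0 x).indicator (fun y => x ^ (-s) * (y ^ s * b y)) y) atTop
      (𝓝 (∫ _ in Ioi (0 : ℝ), (0 : ℝ))) := by
    refine tendsto_integral_filter_of_dominated_convergence (fun y => |b y|) ?_ ?_ hb.abs ?_
    · refine Eventually.of_forall fun x => ?_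
      refine AEStronglyMeasurable.indicator ?_ measurableSet_Ioc
      exact ((((continuousOn_rpow_Ioi s).aestronglyMeasurable measurableSet_Ioi).mul
        hb.aestronglyMeasurable)).const_mul _
    · refine Eventually.of_forall fun x => ae_of_all _ fun y => ?_
      by_cases hy : y ∈ Ioc 0 x
      · rw [indicator_of_mem hy, ← mul_assoc, Real.norm_eq_abs, abs_mul,
          abs_of_nonneg (rpow_neg_mul_rpow_nonneg hy)]
        exact mul_le_of_le_one_left (abs_nonneg _) (rpow_neg_mul_rpow_le_one hs hy)
      · rw [indicator_of_notMem hy, norm_zero]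
        exact abs_nonneg _
    · refine ae_of_all _ fun y => ?_
      have h1 : Tendsto (fun x : ℝ => x ^ (-s) * |y ^ s * b y|) atTop (𝓝 0) := by
        simpa using (tendsto_rpow_neg_atTop hs).mul_const (|y ^ s * b y|)
      refine squeeze_zero_norm' ?_ h1
      filter_upwards [eventually_gt_atTop 0] with x hx
      refine (norm_indicator_le_norm_self _ _).trans_eq ?_
      rw [Real.norm_eq_abs, abs_mul, abs_of_pos (Real.rpow_pos_of_pos hx _)]
  rw [integral_zero] at h
  refine h.congr fun x => ?_
  rw [setIntegral_indicator measurableSet_Ioc, inter_eq_right.2 Ioc_zero_subset,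
    integral_const_mul]

end radial

/-! ### Solutions that are regular at the origin -/

/-- The centrifugal potential. -/
def centrifugal (l x : ℝ) : ℝ := l * (l + 1) / x ^ 2

theorem continuousOn_centrifugal (l : ℝ) : ContinuousOn (centrifugal l) (Ioi 0) :=
  continuousOn_const.div (continuousOn_pow 2) fun _ hx => pow_ne_zero 2 (ne_of_gt hx)

theorem isRealSolution_rpow {l p : ℝ} (hp : p * (p - 1) = l * (l + 1)) :
    IsRealSolution (centrifugal l) (fun x => x ^ p) (fun x => p * x ^ (p - 1)) := by
  refine .of_hasDerivAt (fun x hx => Real.hasDerivAt_rpow_const (Or.inl hx.ne')) (fun x hx => ?_)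
    (continuousOn_centrifugal l)
  have h := (Real.hasDerivAt_rpow_const (x := x) (p := p - 1) (Or.inl hx.ne')).const_mul p
  have e : centrifugal l x * x ^ p = p * ((p - 1) * x ^ (p - 1 - 1)) := by
    rw [centrifugal, ← hp, Real.rpow_sub_one hx.ne', Real.rpow_sub_one hx.ne']
    field_simp
  rw [e]
  exact h

/-- `u` is a real solution of `u'' = (l(l+1)/x² + Q) u` with `x^{-l-1} u(x) → L` as `x → 0`. -/
structure IsRegularWith (l : ℝ) (Q : ℝ → ℝ) (L : ℝ) (u u' : ℝ → ℝ) : Prop where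
  sol : IsRealSolution (fun x => centrifugal l x + Q x) u u'
  lim : Tendsto (fun x => x ^ (-l - 1) * u x) (𝓝[>] 0) (𝓝 L)

theorem exists_bound_Ioc {v : ℝ → ℝ} {L : ℝ} (hv : ContinuousOn v (Ioi 0))
    (hL : Tendsto v (𝓝[>] 0) (𝓝 L)) (X : ℝ) : ∃ M, ∀ x ∈ Ioc 0 X, |v x| ≤ M := by
  have h1 : ∀ᶠ x in 𝓝[>] (0 : ℝ), |v x| < |L| + 1 :=
    hL.abs.eventually_lt_const (by linarith [abs_nonneg L])
  obtain ⟨δ, hδ, h2⟩ := mem_nhdsGT_iff_exists_Ioc_subset.1 h1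
  have hδ : 0 < δ := hδ
  obtain ⟨M, hM⟩ := isCompact_Icc.exists_bound_of_continuousOn
    (hv.mono (fun x hx => hδ.trans_le hx.1 : Icc δ X ⊆ Ioi 0))
  refine ⟨max (|L| + 1) M, fun x hx => ?_⟩
  rcases le_total x δ with h | h
  · exact (le_of_lt (h2 ⟨hx.1, h⟩)).trans (le_max_left _ _)
  · exact (hM x ⟨h, hx.2⟩).trans (le_max_right _ _)

namespace IsRegularWith

variable {l L : ℝ} {Q u u' : ℝ → ℝ}

theorem continuousOn (h : IsRegularWith l Q L u u') :
    ContinuousOn (fun x => x ^ (-l - 1) * u x) (Ioi 0) :=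
  (continuousOn_rpow_Ioi _).mul h.sol.continuousOn

theorem integrableOn (h : IsRegularWith l Q L u u')
    (hQ : ∀ x, 0 < x → IntegrableOn (fun y => y * Q y) (Ioc 0 x)) {x : ℝ} (hx : 0 < x) :
    IntegrableOn (fun y => y * Q y * (y ^ (-l - 1) * u y)) (Ioc 0 x) := by
  obtain ⟨M, hM⟩ := exists_bound_Ioc h.continuousOn h.lim x
  exact integrableOn_mul_of_bdd measurableSet_Ioc Ioc_zero_subset (hQ x hx) h.continuousOn hM

theorem eq_rpow_mul (u : ℝ → ℝ) {x : ℝ} (hx : 0 < x) :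
    u x = x ^ (l + 1) * (x ^ (-l - 1) * u x) := by
  rw [← mul_assoc, ← Real.rpow_add hx]; simp

/-- The integral equation of a regular solution and the corresponding formula for its
derivative. -/
theorem integral_eq (hl : 0 < 2 * l + 1) (h : IsRegularWith l Q L u u')
    (hQ : ∀ x, 0 < x → IntegrableOn (fun y => y * Q y) (Ioc 0 x)) {x : ℝ} (hx : 0 < x) :
    x ^ (-l - 1) * u x =
        L + radialPotential (2 * l + 1) (fun y => y * Q y * (y ^ (-l - 1) * u y)) x ∧
    x ^ (l + 1) * u' x - (l + 1) * x ^ l * u x =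
      ∫ y in Ioc 0 x, y ^ (2 * l + 1) * (y * Q y * (y ^ (-l - 1) * u y)) := by
  set s := 2 * l + 1 with hs
  set b : ℝ → ℝ := fun y => y * Q y * (y ^ (-l - 1) * u y) with hb
  have hbi : ∀ x, 0 < x → IntegrableOn b (Ioc 0 x) := fun x hx => h.integrableOn hQ hx
  have hp : IsRealSolution (centrifugal l) (fun x => x ^ (l + 1)) (fun x => (l + 1) * x ^ l) := by
    simpa using isRealSolution_rpow (l := l) (p := l + 1) (by ring)
  have hm : IsRealSolution (centrifugal l) (fun x => x ^ (-l)) (fun x => -l * x ^ (-l - 1)) :=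
    isRealSolution_rpow (by ring)
  have hA := hm.wronskian h.sol
  have hB := hp.wronskian h.sol
  have eA : HasWeakDeriv (fun x => (x ^ (-l) * u' x - -l * x ^ (-l - 1) * u x)
      - ∫ y in Ioc 0 x, b y) (fun _ => 0) := by
    refine (hA.sub (hasWeakDeriv_integral_Ioc hbi)).congr (fun _ _ => rfl) fun x hx => ?_
    have hx : 0 < x := hx
    have : x ^ (-l) = x * x ^ (-l - 1) := by
      rw [Real.rpow_sub_one hx.ne']; field_simp
    simp only [hb, this]
    ring
  have eB : HasWeakDeriv (fun x => (x ^ (l + 1) * u' x - (l + 1) * x ^ l * u x)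
      - ∫ y in Ioc 0 x, y ^ s * b y) (fun _ => 0) := by
    refine (hB.sub (hasWeakDeriv_integral_Ioc fun x hx =>
      integrableOn_rpow_mul hl (hbi x hx))).congr (fun _ _ => rfl) fun x hx => ?_
    have hx : 0 < x := hx
    have : x ^ s * (x * Q x * (x ^ (-l - 1) * u x)) = Q x * (x ^ (l + 1) * u x) := by
      have h1 : x ^ (l + 1) = x ^ s * x ^ (1 : ℝ) * x ^ (-l - 1) := by
        rw [← Real.rpow_add hx, ← Real.rpow_add hx]; congr 1; rw [hs]; ring
      rw [h1, Real.rpow_one]; ring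
    simp only [hb, this]
    ring
  set cA := (1 ^ (-l) * u' 1 - -l * 1 ^ (-l - 1) * u 1) - ∫ y in Ioc 0 1, b y
  set cB := (1 ^ (l + 1) * u' 1 - (l + 1) * 1 ^ l * u 1) - ∫ y in Ioc 0 1, y ^ s * b y
  have hcA : ∀ x, 0 < x → x ^ (-l) * u' x - -l * x ^ (-l - 1) * u x
      = cA + ∫ y in Ioc 0 x, b y := fun x hx => by
    linarith [eA.eq_of_deriv_zero hx one_pos]
  have hcB : ∀ x, 0 < x → x ^ (l + 1) * u' x - (l + 1) * x ^ l * u x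
      = cB + ∫ y in Ioc 0 x, y ^ s * b y := fun x hx => by
    linarith [eB.eq_of_deriv_zero hx one_pos]
  have hv : ∀ x, 0 < x → s * (x ^ (-l - 1) * u x) = (cA + ∫ y in Ioc 0 x, b y)
      - x ^ (-s) * (cB + ∫ y in Ioc 0 x, y ^ s * b y) := by
    intro x hx
    rw [← hcA x hx, ← hcB x hx]
    have h1 : x ^ (-s) * x ^ (l + 1) = x ^ (-l) := by
      rw [← Real.rpow_add hx]; congr 1; rw [hs]; ring
    have h2 : x ^ (-s) * x ^ l = x ^ (-l - 1) := by
      rw [← Real.rpow_add hx]; congr 1; rw [hs]; ring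
    linear_combination (u' x) * h1 - ((l + 1) * u x) * h2 + (x ^ (-l - 1) * u x) * hs
  have hcB0 : cB = 0 := by
    have hxs : Tendsto (fun x : ℝ => x ^ s) (𝓝[>] 0) (𝓝 0) := by
      have := (Real.continuousAt_rpow_const 0 s (Or.inr hl.le)).tendsto
      rw [Real.zero_rpow hl.ne'] at this
      exact this.mono_left nhdsWithin_le_nhds
    have h1 : Tendsto (fun x : ℝ => x ^ s * ((cA + ∫ y in Ioc 0 x, b y)
        - s * (x ^ (-l - 1) * u x)) - ∫ y in Ioc 0 x, y ^ s * b y) (𝓝[>] 0)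
        (𝓝 (0 * ((cA + 0) - s * L) - 0)) :=
      (hxs.mul ((tendsto_const_nhds.add (tendsto_integral_Ioc_zero one_pos (hbi 1 one_pos))).sub
        (h.lim.const_mul s))).sub (tendsto_integral_Ioc_zero one_pos
          (integrableOn_rpow_mul hl (hbi 1 one_pos)))
    have h2 := tendsto_nhds_unique (h1.congr' (f₂ := fun _ => cB) (by
      filter_upwards [self_mem_nhdsWithin] with x hx
      have hx : 0 < x := hx
      have h3 : x ^ s * x ^ (-s) = 1 := by rw [← Real.rpow_add hx]; simp
      rw [hv x hx]
      linear_combination (cB + ∫ y in Ioc 0 x, y ^ s * b y) * h3)) tendsto_const_nhds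
    simpa using h2.symm
  have hv' : ∀ x, 0 < x → x ^ (-l - 1) * u x = s⁻¹ * cA + radialPotential s b x := by
    intro x hx
    have h1 := hv x hx
    rw [hcB0, zero_add] at h1
    rw [radialPotential, ← mul_add, eq_inv_mul_iff_mul_eq₀ hl.ne', h1]
    ring
  have hcAL : s⁻¹ * cA = L := by
    have h1 : Tendsto (fun x => x ^ (-l - 1) * u x) (𝓝[>] 0) (𝓝 (s⁻¹ * cA + 0)) :=
      (tendsto_const_nhds.add (tendsto_radialPotential_zero hl hbi)).congr' (by
        filter_upwards [self_mem_nhdsWithin] with x hx using (hv' x hx).symm)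
    simpa using tendsto_nhds_unique h1 h.lim
  refine ⟨by rw [hv' x hx, hcAL], ?_⟩
  rw [hcB x hx, hcB0, zero_add]

theorem abs_le (hl : 0 < 2 * l + 1) (h : IsRegularWith l Q L u u')
    (hQ : ∀ x, 0 < x → IntegrableOn (fun y => y * Q y) (Ioc 0 x)) {x : ℝ} (hx : 0 < x) :
    |x ^ (-l - 1) * u x| ≤
      2 * |L| * Real.exp (2 * ∫ y in Ioc 0 x, (2 * l + 1)⁻¹ * |y * Q y|) := by
  obtain ⟨M, hM⟩ := exists_bound_Ioc h.continuousOn h.lim x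
  refine gronwall_Ioc (κ := fun y => (2 * l + 1)⁻¹ * |y * Q y|) (X := x) (M := M)
    (θ := fun x => |x ^ (-l - 1) * u x|) (fun x hx => (hQ x hx).abs.const_mul _)
    (fun x _ => mul_nonneg (inv_pos.2 hl).le (abs_nonneg _)) (abs_nonneg _)
    (fun _ _ => abs_nonneg _) hM (fun y hy => ?_) ⟨hx, le_rfl⟩
  rw [(h.integral_eq hl hQ hy.1).1]
  refine (abs_add_le _ _).trans (add_le_add_right ?_ _)
  refine (abs_radialPotential_le hl (h.integrableOn hQ hy.1)).trans_eq ?_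
  rw [← integral_const_mul]
  refine integral_congr_ae (ae_of_all _ fun t => ?_)
  simp only [abs_mul]
  ring

theorem eq_zero (hl : 0 < 2 * l + 1) (h : IsRegularWith l Q 0 u u')
    (hQ : ∀ x, 0 < x → IntegrableOn (fun y => y * Q y) (Ioc 0 x)) {x : ℝ} (hx : 0 < x) :
    u x = 0 := by
  have h1 := h.abs_le hl hQ hx
  rw [abs_zero, mul_zero, zero_mul] at h1
  rw [eq_rpow_mul (l := l) u hx, abs_nonpos_iff.1 h1, mul_zero]

end IsRegularWith

/-- Existence of the regular solution, with the integral representation of `x^{-l-1} u`. -/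
theorem exists_isRegularWith {l : ℝ} {Q : ℝ → ℝ} (hl : 0 < 2 * l + 1)
    (hQ : ∀ x, 0 < x → IntegrableOn (fun y => y * Q y) (Ioc 0 x)) :
    ∃ u u', IsRegularWith l Q 1 u u' := by
  obtain ⟨v, hvc, -, hi₁, hi₂, hv⟩ := exists_volterra_solution_Ioc
    (κ := fun y => (2 * l + 1)⁻¹ * |y * Q y|) (u₀ := fun _ => 1) (a₁ := fun _ => (2 * l + 1)⁻¹)
    (a₂ := fun x => -((2 * l + 1)⁻¹ * x ^ (-(2 * l + 1)))) (b₁ := fun y => y * Q y)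
    (b₂ := fun y => y ^ (2 * l + 1) * (y * Q y)) (fun x hx => (hQ x hx).abs.const_mul _)
    (fun x _ => mul_nonneg (inv_pos.2 hl).le (abs_nonneg _)) continuousOn_const
    (fun _ _ => by simp) continuousOn_const
    (continuousOn_const.mul (continuousOn_rpow_Ioi _)).neg hQ
    (fun x hx => integrableOn_rpow_mul hl (hQ x hx)) (fun x hx y hy => by
      have h1 : (2 * l + 1)⁻¹ * (y * Q y) + -((2 * l + 1)⁻¹ * x ^ (-(2 * l + 1))) *
          (y ^ (2 * l + 1) * (y * Q y)) = (2 * l + 1)⁻¹ *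
          ((1 - x ^ (-(2 * l + 1)) * y ^ (2 * l + 1)) * (y * Q y)) := by ring
      have h2 := rpow_neg_mul_rpow_le_one hl hy
      have h3 := rpow_neg_mul_rpow_nonneg (s := 2 * l + 1) hy
      rw [h1, abs_mul, abs_of_pos (inv_pos.2 hl)]
      refine mul_le_mul_of_nonneg_left ?_ (inv_pos.2 hl).le
      rw [abs_mul, abs_of_nonneg (by linarith)]
      exact mul_le_of_le_one_left (abs_nonneg _) (by linarith))
  set s := 2 * l + 1 with hs
  have hv' : ∀ x, 0 < x → v x = 1 + radialPotential s (fun y => y * Q y * v y) x := by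
    intro x hx
    rw [hv x hx, radialPotential]
    simp only [mul_assoc]
    ring
  have hi₂' : ∀ x, 0 < x → IntegrableOn (fun y => y ^ s * (y * Q y * v y)) (Ioc 0 x) :=
    fun x hx => integrableOn_rpow_mul hl (hi₁ x hx)
  have hp : IsRealSolution (centrifugal l) (fun x => x ^ (l + 1)) (fun x => (l + 1) * x ^ l) := by
    simpa using isRealSolution_rpow (l := l) (p := l + 1) (by ring)
  have hm : IsRealSolution (centrifugal l) (fun x => x ^ (-l)) (fun x => -l * x ^ (-l - 1)) :=
    isRealSolution_rpow (by ring)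
  refine ⟨fun x => x ^ (l + 1) * v x, _, .of_variation hp hm
    (((hasWeakDeriv_integral_Ioc hi₁).const_mul s⁻¹).const_add 1)
    ((hasWeakDeriv_integral_Ioc hi₂').const_mul (-s⁻¹)) (fun x hx => ?_) (fun x hx => ?_)
    (fun x hx => ?_), ?_⟩
  · have h1 : x ^ (-l) = x ^ (-s) * x ^ (l + 1) := by
      rw [← Real.rpow_add hx]; congr 1; rw [hs]; ring
    rw [hv' x hx, radialPotential, h1]
    ring
  · have h1 : x ^ (l + 1) = x ^ s * x ^ (-l) := by
      rw [← Real.rpow_add hx]; congr 1; rw [hs]; ring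
    rw [h1]; ring
  · have h1 : x ^ l = x ^ s * x ^ (-l - 1) := by
      rw [← Real.rpow_add hx]; congr 1; rw [hs]; ring
    have h2 : x ^ (l + 1) = x ^ l * x := by
      rw [Real.rpow_add hx, Real.rpow_one]
    rw [h2]
    have h3 : s⁻¹ * s = 1 := inv_mul_cancel₀ hl.ne'
    linear_combination (-(s⁻¹ * l * x * Q x * v x)) * h1 + (x * Q x * v x * x ^ l) * h3
      + (-(s⁻¹ * x * Q x * v x * x ^ l)) * hs
  · have h1 : Tendsto v (𝓝[>] 0) (𝓝 (1 + 0)) :=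
      (tendsto_const_nhds.add (tendsto_radialPotential_zero hl hi₁)).congr' (by
        filter_upwards [self_mem_nhdsWithin] with x hx using (hv' x hx).symm)
    rw [add_zero] at h1
    refine h1.congr' ?_
    filter_upwards [self_mem_nhdsWithin] with x hx
    have hx : 0 < x := hx
    rw [← mul_assoc, ← Real.rpow_add hx]
    simp

/-! ### Integrability of potentials of the Marchenko class -/

namespace MarchenkoClass

variable {q : ℝ → ℝ}

theorem intervalIntegrable (hq : MarchenkoClass q) (a b : ℝ) (ha : 0 < a) (hb : 0 < b) :
    IntervalIntegrable q volume a b :=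
  (hq.locallyIntegrable.integrableOn_compact_subset (uIcc_subset_Ioi ha hb)
    isCompact_uIcc).intervalIntegrable

theorem integrableOn_mul (hq : MarchenkoClass q) : IntegrableOn (fun x => x * q x) (Ioi 0) := by
  have h : IntegrableOn (fun x => x * |q x|) (Ioi 0) := by
    rw [← Ioc_union_Ioi_eq_Ioi (zero_le_one' ℝ)]
    exact hq.integrable_near_zero.union hq.integrable_at_top
  refine h.mono' (measurable_id.aestronglyMeasurable.mul
    hq.locallyIntegrable.aestronglyMeasurable) ?_
  refine (ae_restrict_iff' measurableSet_Ioi).2 (ae_of_all _ fun x hx => ?_)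
  have hx : 0 < x := hx
  simp only [Real.norm_eq_abs, abs_mul, abs_of_pos hx, le_refl]

theorem integrableOn_mul_sub (hq : MarchenkoClass q) (z : ℝ) (x : ℝ) (_ : 0 < x) :
    IntegrableOn (fun y => y * (q y - z)) (Ioc 0 x) := by
  have h1 : IntegrableOn (fun y : ℝ => y * z) (Ioc 0 x) :=
    ((continuous_id.mul continuous_const).integrableOn_Icc).mono_set Ioc_subset_Icc_self
  exact ((hq.integrableOn_mul.mono_set Ioc_zero_subset).sub h1).congr
    (ae_of_all _ fun y => (mul_sub y (q y) z).symm)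

theorem integrableOn_Ioi (hq : MarchenkoClass q) {x : ℝ} (hx : 0 < x) : IntegrableOn q (Ioi x) := by
  refine (integrableOn_mul_of_bdd (g := fun y => y⁻¹) (c := x⁻¹) measurableSet_Ioi
    (Ioi_subset_Ioi_zero hx) (hq.integrableOn_mul.mono_set (Ioi_subset_Ioi_zero hx))
    (continuousOn_inv₀.mono fun y hy => ne_of_gt hy) fun y hy => ?_).congr_fun
    (fun y hy => ?_) measurableSet_Ioi
  · have hy0 : 0 < y := hx.trans hy
    rw [abs_of_pos (inv_pos.2 hy0)]
    exact inv_anti₀ hx (le_of_lt hy)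
  · have hy0 : 0 < y := hx.trans hy
    simp only
    field_simp

end MarchenkoClass

theorem integrableOn_centrifugal (l : ℝ) {x : ℝ} (hx : 0 < x) :
    IntegrableOn (centrifugal l) (Ioi x) := by
  have h : IntegrableOn (fun y : ℝ => l * (l + 1) * y ^ (-2 : ℝ)) (Ioi x) :=
    (integrableOn_Ioi_rpow_of_lt (by norm_num) hx).const_mul _
  refine h.congr_fun (fun y hy => ?_) measurableSet_Ioi
  have hy0 : 0 < y := hx.trans hy
  simp only [centrifugal]
  rw [Real.rpow_neg hy0.le, div_eq_mul_inv]
  norm_num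

theorem integrableOn_potential {q : ℝ → ℝ} (hq : MarchenkoClass q) (l : ℝ) {x : ℝ} (hx : 0 < x) :
    IntegrableOn (fun y => centrifugal l y + q y) (Ioi x) :=
  (integrableOn_centrifugal l hx).add (hq.integrableOn_Ioi hx)

theorem intervalIntegrable_potential {q : ℝ → ℝ} (hq : MarchenkoClass q) (l z a b : ℝ)
    (ha : 0 < a) (hb : 0 < b) :
    IntervalIntegrable (fun y => centrifugal l y + (q y - z)) volume a b :=
  ((continuousOn_centrifugal l).mono (uIcc_subset_Ioi ha hb)).intervalIntegrable.add
    ((hq.intervalIntegrable a b ha hb).sub intervalIntegrable_const)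

/-! ### Real and imaginary parts of complex solutions -/

section complex

variable {l z : ℝ} {q : ℝ → ℝ}

theorem potential_eq (l z : ℝ) (q : ℝ → ℝ) (x : ℝ) :
    ((l * (l + 1) / x ^ 2 + q x : ℝ) : ℂ) - (z : ℂ)
      = ((centrifugal l x + (q x - z) : ℝ) : ℂ) := by
  rw [centrifugal]; push_cast; ring

theorem IsSolution.comp_clm (hq : MarchenkoClass q) {u : ℝ → ℂ} (h : IsSolution l q z u)
    (φ : ℂ →L[ℝ] ℝ) :
    IsRealSolution (fun x => centrifugal l x + (q x - z)) (fun x => φ (u x))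
      (fun x => φ (deriv u x)) := by
  refine ⟨fun x hx => φ.hasFDerivAt.comp_hasDerivAt x (h.differentiableAt x hx).hasDerivAt, ?_⟩
  intro a b ha hb
  have hc : ContinuousOn u (uIcc a b) := fun x hx =>
    (h.differentiableAt x (uIcc_subset_Ioi ha hb hx)).continuousAt.continuousWithinAt
  have hV := intervalIntegrable_potential hq l z a b ha hb
  have hi : IntervalIntegrable (fun x => ((centrifugal l x + (q x - z) : ℝ)) • u x) volume a b :=
    hV.smul_continuousOn hc
  have he : ∀ x, φ ((centrifugal l x + (q x - z) : ℝ) • u x)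
      = (centrifugal l x + (q x - z)) * φ (u x) := fun x => by rw [map_smul, smul_eq_mul]
  refine ⟨hV.mul_continuousOn (φ.continuous.comp_continuousOn hc), ?_⟩
  have h1 := h.deriv_sub_deriv a b ha hb
  simp only [potential_eq, ← Complex.real_smul] at h1
  simp only [← map_sub, h1, ← φ.intervalIntegral_comp_comm hi, he]

theorem isSolution_of_real {u u' v v' : ℝ → ℝ}
    (hu : IsRealSolution (fun x => centrifugal l x + (q x - z)) u u')
    (hv : IsRealSolution (fun x => centrifugal l x + (q x - z)) v v') :
    (∀ x, 0 < x → HasDerivAt (fun x => (u x : ℂ) + Complex.I * v x)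
      (u' x + Complex.I * v' x) x) ∧
    IsSolution l q z (fun x => u x + Complex.I * v x) := by
  have hd : ∀ x, 0 < x → HasDerivAt (fun x => (u x : ℂ) + Complex.I * v x)
      (u' x + Complex.I * v' x) x := fun x hx =>
    (hu.hasDerivAt x hx).ofReal_comp.add ((hv.hasDerivAt x hx).ofReal_comp.const_mul Complex.I)
  refine ⟨hd, fun x hx => (hd x hx).differentiableAt, fun a b ha hb => ?_⟩
  rw [(hd a ha).deriv, (hd b hb).deriv]
  obtain ⟨i1, h1⟩ := hu.weak a b ha hb
  obtain ⟨i2, h2⟩ := hv.weak a b ha hb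
  have e : ∀ x, (((l * (l + 1) / x ^ 2 + q x : ℝ) : ℂ) - z) * (u x + Complex.I * v x)
      = (((centrifugal l x + (q x - z)) * u x : ℝ) : ℂ)
        + Complex.I * (((centrifugal l x + (q x - z)) * v x : ℝ) : ℂ) := by
    intro x
    rw [potential_eq]; push_cast; ring
  have hof : ∀ f : ℝ → ℝ, IntervalIntegrable f volume a b →
      IntervalIntegrable (fun x => (f x : ℂ)) volume a b := fun f hf =>
    ⟨Integrable.ofReal hf.1, Integrable.ofReal hf.2⟩
  simp only [e]
  rw [intervalIntegral.integral_add (hof _ i1) ((hof _ i2).const_mul _),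
    intervalIntegral.integral_const_mul, intervalIntegral.integral_ofReal,
    intervalIntegral.integral_ofReal, ← h1, ← h2]
  push_cast
  ring

end complex

/-! ### The regular solution -/

theorem radialPotential_eq_integral {s : ℝ} {b : ℝ → ℝ} (hs : 0 < s)
    (hb : ∀ x, 0 < x → IntegrableOn b (Ioc 0 x)) {x : ℝ} (hx : 0 < x) :
    IntervalIntegrable (fun y => y ^ (-s - 1) * ∫ t in Ioc 0 y, t ^ s * b t) volume 0 x ∧
    ∫ y in (0 : ℝ)..x, y ^ (-s - 1) * (∫ t in Ioc 0 y, t ^ s * b t) = radialPotential s b x := by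
  have hzero : ∀ b : ℝ → ℝ, radialPotential s b 0 = 0 := fun b => by simp [radialPotential]
  have hcont : ∀ b : ℝ → ℝ, (∀ x, 0 < x → IntegrableOn b (Ioc 0 x)) →
      ContinuousOn (radialPotential s b) (Icc 0 x) := by
    intro b hb y hy
    rcases hy.1.eq_or_lt with h | h
    · rw [← h]
      have h1 : ContinuousWithinAt (radialPotential s b) (Ioi 0) 0 := by
        rw [ContinuousWithinAt, hzero]
        exact tendsto_radialPotential_zero hs hb
      exact (continuousWithinAt_Ioi_iff_Ici.1 h1).mono Icc_subset_Ici_self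
    · exact (hasDerivAt_radialPotential hs hb h).continuousAt.continuousWithinAt
  have hB := hasWeakDeriv_integral_Ioc fun y hy => integrableOn_rpow_mul hs (hb y hy)
  have hi : IntervalIntegrable (fun y => y ^ (-s - 1) * ∫ t in Ioc 0 y, t ^ s * |b t|)
      volume 0 x := by
    refine intervalIntegral.intervalIntegrable_deriv_of_nonneg
      (g := radialPotential s fun y => |b y|) ?_ ?_ ?_
    · rw [uIcc_of_le hx.le]
      exact hcont _ fun y hy => (hb y hy).abs
    · intro y hy
      rw [min_eq_left hx.le] at hy
      exact hasDerivAt_radialPotential hs (fun y hy => (hb y hy).abs) hy.1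
    · intro y hy
      rw [min_eq_left hx.le] at hy
      exact mul_nonneg (Real.rpow_nonneg hy.1.le _) (setIntegral_nonneg measurableSet_Ioc
        fun t ht => mul_nonneg (Real.rpow_nonneg ht.1.le _) (abs_nonneg _))
  have hi' : IntervalIntegrable (fun y => y ^ (-s - 1) * ∫ t in Ioc 0 y, t ^ s * b t)
      volume 0 x := by
    rw [intervalIntegrable_iff_integrableOn_Ioc_of_le hx.le] at hi ⊢
    refine hi.mono' ((((continuousOn_rpow_Ioi _).mul hB.continuousOn).mono
      Ioc_zero_subset).aestronglyMeasurable measurableSet_Ioc) ?_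
    refine (ae_restrict_iff' measurableSet_Ioc).2 (ae_of_all _ fun y hy => ?_)
    rw [norm_mul, Real.norm_of_nonneg (Real.rpow_nonneg hy.1.le _)]
    refine mul_le_mul_of_nonneg_left ?_ (Real.rpow_nonneg hy.1.le _)
    refine norm_integral_le_of_norm_le (integrableOn_rpow_mul hs (hb y hy.1).abs) ?_
    refine (ae_restrict_iff' measurableSet_Ioc).2 (ae_of_all _ fun t ht => ?_)
    rw [norm_mul, Real.norm_of_nonneg (Real.rpow_nonneg ht.1.le _), Real.norm_eq_abs]
  refine ⟨hi', ?_⟩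
  rw [intervalIntegral.integral_eq_sub_of_hasDerivAt_of_le hx.le (hcont b hb)
    (fun y hy => hasDerivAt_radialPotential hs hb hy.1) hi', hzero, sub_zero]

theorem regularConst_pos {l : ℝ} (hl : 0 < 2 * l + 1) : 0 < regularConst l := by
  have := Real.Gamma_pos_of_pos (show 0 < l + 3 / 2 by linarith)
  have := Real.pi_pos
  unfold regularConst
  positivity

theorem exists_isRegularSolution {l : ℝ} {q : ℝ → ℝ} (hl : 0 < 2 * l + 1) (hq : MarchenkoClass q)
    (z : ℝ) : ∃ u, IsRegularSolution l q z u := by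
  obtain ⟨u, u', h⟩ := exists_isRegularWith (Q := fun x => q x - z) hl (hq.integrableOn_mul_sub z)
  set b : ℝ → ℝ := fun y => y * (q y - z) * (y ^ (-l - 1) * u y)
  have hb : ∀ x, 0 < x → IntegrableOn b (Ioc 0 x) := fun x hx =>
    h.integrableOn (hq.integrableOn_mul_sub z) hx
  have hR := fun x hx => radialPotential_eq_integral hl hb (x := x) hx
  have hs := isSolution_of_real (h.sol.const_mul (regularConst l)) (h.sol.const_mul 0)
  refine ⟨_, hs.2, fun y => ((y ^ (-(2 * l + 1) - 1) *
    ∫ t in Ioc 0 y, t ^ (2 * l + 1) * b t : ℝ) : ℂ), ?_, fun x hx => ?_⟩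
  · exact ((intervalIntegrable_iff_integrableOn_Ioc_of_le zero_le_one).1
      (hR 1 one_pos).1).ofReal
  · rw [intervalIntegral.integral_ofReal, (hR x hx.1).2]
    have h1 := (h.integral_eq hl (hq.integrableOn_mul_sub z) hx.1).1
    have h2 := IsRegularWith.eq_rpow_mul (l := l) u hx.1
    rw [h2, h1]
    push_cast
    ring

/-- The regular solution at a real energy is real. -/
theorem exists_isRegularWith_regularSolution {l : ℝ} {q : ℝ → ℝ} (hl : 0 < 2 * l + 1)
    (hq : MarchenkoClass q) (z : ℝ) :
    ∃ u u', IsRegularWith l (fun x => q x - z) (regularConst l) u u' ∧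
      ∀ x, 0 < x → regularSolution l q z x = u x ∧ deriv (regularSolution l q z) x = u' x := by
  have hex := exists_isRegularSolution hl hq z
  have hr : IsRegularSolution l q z (regularSolution l q z) := by
    rw [regularSolution, dif_pos hex]; exact hex.choose_spec
  set r := regularSolution l q z
  obtain ⟨g, hg, hrg⟩ := hr.normalized
  have key : ∀ φ : ℂ →L[ℝ] ℝ, IsRegularWith l (fun x => q x - z) (regularConst l * φ 1)
      (fun x => φ (r x)) (fun x => φ (deriv r x)) := by
    intro φ
    refine ⟨hr.isSolution.comp_clm hq φ, ?_⟩
    have hφg : IntegrableOn (fun y => φ (g y)) (Ioc 0 1) := φ.integrable_comp hg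
    have h1 : Tendsto (fun x => regularConst l * (φ 1 + ∫ y in Ioc 0 x, φ (g y))) (𝓝[>] 0)
        (𝓝 (regularConst l * (φ 1 + 0))) :=
      (tendsto_const_nhds.add (tendsto_integral_Ioc_zero one_pos hφg)).const_mul _
    rw [add_zero] at h1
    refine h1.congr' ?_
    filter_upwards [Ioc_mem_nhdsGT one_pos] with x hx
    rw [hrg x hx, ← Complex.real_smul, map_smul, map_add, smul_eq_mul,
      intervalIntegral.integral_of_le hx.1.le,
      ← φ.integral_comp_comm (hg.mono_set (Ioc_subset_Ioc_right hx.2))]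
    have h2 : x ^ (-l - 1) * x ^ (l + 1) = 1 := by rw [← Real.rpow_add hx.1]; simp
    linear_combination (-(regularConst l * (φ 1 + ∫ y in Ioc 0 x, φ (g y)))) * h2
  have hre := key Complex.reCLM
  have him := key Complex.imCLM
  simp only [Complex.reCLM_apply, Complex.imCLM_apply, Complex.one_re, Complex.one_im, mul_one,
    mul_zero] at hre him
  have him0 : ∀ x, 0 < x → (r x).im = 0 := fun x hx =>
    him.eq_zero hl (hq.integrableOn_mul_sub z) hx
  refine ⟨_, _, hre, fun x hx => ⟨Complex.ext rfl (him0 x hx), Complex.ext rfl ?_⟩⟩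
  have h1 : HasDerivAt (fun x => (r x).im) 0 x := by
    refine (hasDerivAt_const x (0 : ℝ)).congr_of_eventuallyEq ?_
    filter_upwards [Ioi_mem_nhds hx] with y hy using him0 y hy
  simpa using (him.sol.hasDerivAt x hx).unique h1

/-! ### The Jost solution -/

/-- Solutions of `u'' = (-k² + V) u` with prescribed oscillatory behaviour at infinity. -/
theorem exists_oscillating_solution {V : ℝ → ℝ} (hV : ∀ x, 0 < x → IntegrableOn V (Ioi x)) {k : ℝ}
    (hk : k ≠ 0) (δ : ℝ) :
    ∃ u A B : ℝ → ℝ,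
      IsRealSolution (fun x => -k ^ 2 + V x) u
        (fun x => A x * (-k * Real.sin (k * x)) + B x * (k * Real.cos (k * x))) ∧
      (∀ x, 0 < x → u x = A x * Real.cos (k * x) + B x * Real.sin (k * x)) ∧
      Tendsto A atTop (𝓝 (Real.cos δ)) ∧ Tendsto B atTop (𝓝 (Real.sin δ)) := by
  have hcos : Continuous fun x : ℝ => Real.cos (k * x) := by fun_prop
  have hsin : Continuous fun x : ℝ => Real.sin (k * x) := by fun_prop
  obtain ⟨u, -, -, hi₁, hi₂, hu⟩ := exists_volterra_solution_Ioi
    (κ := fun y => |V y| / |k|) (u₀ := fun x => Real.cos (k * x - δ))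
    (a₁ := fun x => -(Real.sin (k * x) / k)) (a₂ := fun x => Real.cos (k * x) / k)
    (b₁ := fun y => V y * Real.cos (k * y)) (b₂ := fun y => V y * Real.sin (k * y))
    (fun x hx => (hV x hx).abs.div_const _) (fun x _ => by positivity)
    (Continuous.continuousOn (by fun_prop)) (fun x _ => Real.abs_cos_le_one _)
    (hsin.div_const k).neg.continuousOn (hcos.div_const k).continuousOn
    (fun x hx => integrableOn_mul_of_bdd measurableSet_Ioi (Ioi_subset_Ioi_zero hx) (hV x hx)
      hcos.continuousOn fun y _ => Real.abs_cos_le_one _)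
    (fun x hx => integrableOn_mul_of_bdd measurableSet_Ioi (Ioi_subset_Ioi_zero hx) (hV x hx)
      hsin.continuousOn fun y _ => Real.abs_sin_le_one _)
    (fun x _ y _ => by
      have h1 : -(Real.sin (k * x) / k) * (V y * Real.cos (k * y))
          + Real.cos (k * x) / k * (V y * Real.sin (k * y))
          = -(V y * Real.sin (k * x - k * y) / k) := by
        rw [Real.sin_sub]; ring
      rw [h1, abs_neg, abs_div, abs_mul]
      gcongr
      exact mul_le_of_le_one_right (abs_nonneg _) (Real.abs_sin_le_one _))
  have hc : IsRealSolution (fun _ => -k ^ 2) (fun x => Real.cos (k * x))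
      (fun x => -k * Real.sin (k * x)) := by
    refine .of_hasDerivAt (fun x _ => ?_) (fun x _ => ?_) continuousOn_const
    · have := (((hasDerivAt_id x).const_mul k).cos)
      simp only [id, mul_one] at this
      exact this.congr_deriv (by ring)
    · have := (((hasDerivAt_id x).const_mul k).sin).const_mul (-k)
      simp only [id, mul_one] at this
      exact this.congr_deriv (by ring)
  have hs : IsRealSolution (fun _ => -k ^ 2) (fun x => Real.sin (k * x))
      (fun x => k * Real.cos (k * x)) := by
    refine .of_hasDerivAt (fun x _ => ?_) (fun x _ => ?_) continuousOn_const
    · have := (((hasDerivAt_id x).const_mul k).sin)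
      simp only [id, mul_one] at this
      exact this.congr_deriv (by ring)
    · have := (((hasDerivAt_id x).const_mul k).cos).const_mul k
      simp only [id, mul_one] at this
      exact this.congr_deriv (by ring)
  have hrep : ∀ x, 0 < x → u x = (Real.cos δ + k⁻¹ * ∫ y in Ioi x, V y * Real.sin (k * y) * u y)
      * Real.cos (k * x) + (Real.sin δ + -k⁻¹ * ∫ y in Ioi x, V y * Real.cos (k * y) * u y)
      * Real.sin (k * x) := by
    intro x hx
    rw [hu x hx, Real.cos_sub]
    ring
  refine ⟨u, _, _, .of_variation hc hs
    (((hasWeakDeriv_integral_Ioi hi₂).const_mul k⁻¹).const_add (Real.cos δ))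
    (((hasWeakDeriv_integral_Ioi hi₁).const_mul (-k⁻¹)).const_add (Real.sin δ)) hrep
    (fun x _ => by ring) (fun x _ => ?_), hrep, ?_, ?_⟩
  · have h1 := Real.sin_sq_add_cos_sq (k * x)
    have h2 : k⁻¹ * k = 1 := inv_mul_cancel₀ hk
    linear_combination (V x * u x) * h1 + (V x * u x * (Real.sin (k * x) ^ 2
      + Real.cos (k * x) ^ 2)) * h2
  · simpa using ((tendsto_integral_Ioi_atTop (hi₂ 1 one_pos)).const_mul k⁻¹).const_add (Real.cos δ)
  · simpa using ((tendsto_integral_Ioi_atTop (hi₁ 1 one_pos)).const_mul (-k⁻¹)).const_add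
      (Real.sin δ)

theorem exp_I_mul_eq (k x : ℝ) : Complex.exp (Complex.I * k * x)
    = (Real.cos (k * x) : ℂ) + Real.sin (k * x) * Complex.I := by
  have : Complex.I * k * x = ((k * x : ℝ) : ℂ) * Complex.I := by push_cast; ring
  rw [this, Complex.exp_mul_I, Complex.ofReal_cos, Complex.ofReal_sin]

theorem norm_exp_I_mul (k x : ℝ) : ‖Complex.exp (Complex.I * k * x)‖ = 1 := by
  have : Complex.I * k * x = ((k * x : ℝ) : ℂ) * Complex.I := by push_cast; ring
  rw [this, Complex.norm_exp_ofReal_mul_I]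

theorem tendsto_div_exp {P R : ℝ → ℂ} (hP : Tendsto P atTop (𝓝 1))
    (hR : Tendsto R atTop (𝓝 Complex.I)) (k : ℝ) :
    Tendsto (fun x : ℝ => (P x * Real.cos (k * x) + R x * Real.sin (k * x)) /
      Complex.exp (Complex.I * k * x)) atTop (𝓝 1) := by
  rw [tendsto_iff_norm_sub_tendsto_zero] at hP hR ⊢
  have h := hP.add hR
  rw [add_zero] at h
  refine squeeze_zero (fun _ => norm_nonneg _) (fun x => ?_) h
  have h1 : (P x * Real.cos (k * x) + R x * Real.sin (k * x)) / Complex.exp (Complex.I * k * x) - 1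
      = ((P x - 1) * Real.cos (k * x) + (R x - Complex.I) * Real.sin (k * x)) /
        Complex.exp (Complex.I * k * x) := by
    rw [div_sub_one (Complex.exp_ne_zero _)]
    congr 1
    rw [exp_I_mul_eq]
    ring
  rw [h1, norm_div, norm_exp_I_mul, div_one]
  refine (norm_add_le _ _).trans (add_le_add ?_ ?_)
  · rw [norm_mul, Complex.norm_real]
    exact mul_le_of_le_one_right (norm_nonneg _) (Real.abs_cos_le_one _)
  · rw [norm_mul, Complex.norm_real]
    exact mul_le_of_le_one_right (norm_nonneg _) (Real.abs_sin_le_one _)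

theorem exists_isJostSolution {l : ℝ} {q : ℝ → ℝ} (hq : MarchenkoClass q) {k : ℝ} (hk : k ≠ 0) :
    ∃ u, IsJostSolution l q k u := by
  obtain ⟨c, A, B, hc, hcr, hA, hB⟩ :=
    exists_oscillating_solution (fun x hx => integrableOn_potential hq l hx) hk 0
  obtain ⟨d, A', B', hd, hdr, hA', hB'⟩ :=
    exists_oscillating_solution (fun x hx => integrableOn_potential hq l hx) hk (Real.pi / 2)
  simp only [Real.cos_zero, Real.sin_zero, Real.cos_pi_div_two, Real.sin_pi_div_two] at hA hB hA' hB'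
  have hQ : EqOn (fun x => -k ^ 2 + (centrifugal l x + q x))
      (fun x => centrifugal l x + (q x - k ^ 2)) (Ioi 0) := fun x _ => by ring
  obtain ⟨hder, hsol⟩ := isSolution_of_real (hc.congr hQ) (hd.congr hQ)
  have hP : Tendsto (fun x => (A x : ℂ) + Complex.I * A' x) atTop (𝓝 1) := by
    have := hA.ofReal.add (hA'.ofReal.const_mul Complex.I)
    simpa using this
  have hR : Tendsto (fun x => (B x : ℂ) + Complex.I * B' x) atTop (𝓝 Complex.I) := by
    have := hB.ofReal.add (hB'.ofReal.const_mul Complex.I)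
    simpa using this
  have hkc : (k : ℂ) ≠ 0 := Complex.ofReal_ne_zero.2 hk
  refine ⟨fun x => c x + Complex.I * d x, by simpa using hsol, ?_, ?_⟩
  · refine (tendsto_div_exp hP hR k).congr' ?_
    filter_upwards [eventually_gt_atTop 0] with x hx
    rw [hcr x hx, hdr x hx]
    push_cast
    ring
  · have hP' : Tendsto (fun x => -Complex.I * ((B x : ℂ) + Complex.I * B' x)) atTop (𝓝 1) := by
      simpa using hR.const_mul (-Complex.I)
    have hR' : Tendsto (fun x => Complex.I * ((A x : ℂ) + Complex.I * A' x)) atTop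
        (𝓝 Complex.I) := by
      simpa using hP.const_mul Complex.I
    refine (tendsto_div_exp hP' hR' k).congr' ?_
    filter_upwards [eventually_gt_atTop 0] with x hx
    rw [(hder x hx).deriv]
    have he := Complex.exp_ne_zero (Complex.I * k * x)
    have hI := Complex.I_mul_I
    field_simp
    push_cast
    linear_combination (k * (A x + Complex.I * A' x) * Complex.sin (k * x)
      - k * (B x + Complex.I * B' x) * Complex.cos (k * x)) * hI

/-- The energy of the regular solution is controlled by the Jost function. -/
theorem exists_regular_energy_le {l : ℝ} {q : ℝ → ℝ} (hl : 0 < 2 * l + 1) (hq : MarchenkoClass q)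
    {k : ℝ} (hk : k ≠ 0) :
    ∃ u u', IsRegularWith l (fun x => q x - k ^ 2) (regularConst l) u u' ∧ ∀ X, 0 < X →
      u' X ^ 2 + k ^ 2 * u X ^ 2 ≤ 8 * ‖jostFunction l q k‖ ^ 2 *
        Real.exp (2 * ∫ y in Ioi X, |centrifugal l y + q y| / |k|) := by
  obtain ⟨u, u', hu, hru⟩ := exists_isRegularWith_regularSolution hl hq (k ^ 2)
  refine ⟨u, u', hu, fun X hX => ?_⟩
  have hex := exists_isJostSolution (l := l) hq hk
  have hj : IsJostSolution l q k (jostSolution l q k) := by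
    rw [jostSolution, dif_pos hex]; exact hex.choose_spec
  have hjf : jostFunction l q k
      = wronskian (jostSolution l q k) (regularSolution l q ((k ^ 2 : ℝ) : ℂ)) 1 := by
    rw [jostFunction, Complex.ofReal_pow]
  set r := regularSolution l q ((k ^ 2 : ℝ) : ℂ)
  set j := jostSolution l q k
  have hjs : IsSolution l q ((k ^ 2 : ℝ) : ℂ) j := by
    rw [Complex.ofReal_pow]; exact hj.isSolution
  have hW : ∀ φ : ℂ →L[ℝ] ℝ, ∀ x, 0 < x → φ (j x) * u' x - φ (deriv j x) * u x
      = φ (j 1) * u' 1 - φ (deriv j 1) * u 1 := fun φ x hx =>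
    (((hjs.comp_clm hq φ).wronskian hu.sol).congr (fun _ _ => rfl)
      (fun x _ => by ring)).eq_of_deriv_zero hx one_pos
  have hWx : ∀ x, 0 < x → j x * u' x - deriv j x * u x = jostFunction l q k := by
    intro x hx
    rw [hjf, SphericalSchrodinger.wronskian, (hru 1 one_pos).1, (hru 1 one_pos).2]
    refine Complex.ext ?_ ?_
    · simpa using hW Complex.reCLM x hx
    · simpa using hW Complex.imCLM x hx
  have hkc : (k : ℂ) ≠ 0 := Complex.ofReal_ne_zero.2 hk
  have h14 : (0 : ℝ) < 1 / 4 := by norm_num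
  obtain ⟨b, hbX, hb1, hb2⟩ := ((eventually_ge_atTop X).and
    (((Metric.tendsto_nhds.1 hj.tendsto_value _ h14)).and
      (Metric.tendsto_nhds.1 hj.tendsto_deriv _ h14))).exists
  have hb : 0 < b := hX.trans_le hbX
  have hE : u' b ^ 2 + k ^ 2 * u b ^ 2 ≤ 4 * ‖jostFunction l q k‖ ^ 2 := by
    set e := Complex.exp (Complex.I * k * b) with he
    have he0 : e ≠ 0 := Complex.exp_ne_zero _
    set p := j b / e with hp
    set p' := deriv j b / (Complex.I * k * e) with hp'
    have h1 : jostFunction l q k = e * ((u' b - Complex.I * (k * u b : ℝ)) + ((p - 1) * u' b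
        - (p' - 1) * (Complex.I * (k * u b : ℝ)))) := by
      rw [← hWx b hb, hp, hp']
      have hI := Complex.I_ne_zero
      push_cast
      field_simp
      ring
    set N := ‖(u' b : ℂ) - Complex.I * (k * u b : ℝ)‖ with hN
    have hN2 : N ^ 2 = u' b ^ 2 + k ^ 2 * u b ^ 2 := by
      rw [hN, Complex.sq_norm, Complex.normSq_apply]
      simp
      ring
    have hN0 : 0 ≤ N := norm_nonneg _
    have hu1 : |u' b| ≤ N := abs_le_of_sq_le_sq
      (by rw [hN2]; linarith [mul_nonneg (sq_nonneg k) (sq_nonneg (u b))]) hN0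
    have hu2 : |k * u b| ≤ N :=
      abs_le_of_sq_le_sq (by rw [hN2, mul_pow]; linarith [sq_nonneg (u' b)]) hN0
    have h2 : ‖(p - 1) * u' b - (p' - 1) * (Complex.I * (k * u b : ℝ))‖ ≤ 1 / 4 * N + 1 / 4 * N := by
      refine (norm_sub_le _ _).trans (add_le_add ?_ ?_)
      · rw [norm_mul, Complex.norm_real, ← dist_eq_norm]
        exact mul_le_mul hb1.le hu1 (norm_nonneg _) h14.le
      · rw [norm_mul, norm_mul, Complex.norm_I, one_mul, Complex.norm_real, ← dist_eq_norm]
        exact mul_le_mul hb2.le hu2 (norm_nonneg _) h14.le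
    have h3 : N ≤ 2 * ‖jostFunction l q k‖ := by
      rw [h1, norm_mul, he, norm_exp_I_mul, one_mul]
      have h4 := norm_sub_le_norm_add ((u' b : ℂ) - Complex.I * (k * u b : ℝ))
        ((p - 1) * u' b - (p' - 1) * (Complex.I * (k * u b : ℝ)))
      linarith
    rw [← hN2]
    nlinarith
  have hen := hu.sol.energy_le (intervalIntegrable_potential hq l (k ^ 2)) (abs_pos.2 hk) hX hbX
  rw [sq_abs] at hen
  have hInt : ∫ y in Ioc X b, |centrifugal l y + (q y - k ^ 2) + k ^ 2| / |k|
      ≤ ∫ y in Ioi X, |centrifugal l y + q y| / |k| := by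
    have : ∀ y, centrifugal l y + (q y - k ^ 2) + k ^ 2 = centrifugal l y + q y := fun y => by ring
    simp only [this]
    refine setIntegral_mono_set ((integrableOn_potential hq l hX).abs.div_const _)
      (ae_of_all _ fun y => by positivity) (Eventually.of_forall fun y hy => hy.1)
  refine hen.trans ?_
  refine mul_le_mul (by linarith) ?_ (Real.exp_nonneg _) (by positivity)
  exact Real.exp_le_exp.2 (mul_le_mul_of_nonneg_left hInt zero_le_two)

/-! ### Zero energy -/

theorem IsRealSolution.sub {Q u u' v v' : ℝ → ℝ} (hu : IsRealSolution Q u u')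
    (hv : IsRealSolution Q v v') :
    IsRealSolution Q (fun x => u x - v x) (fun x => u' x - v' x) :=
  ⟨fun x hx => (hu.hasDerivAt x hx).sub (hv.hasDerivAt x hx),
    (hu.weak.sub hv.weak).congr (fun _ _ => rfl) fun x _ => by ring⟩

/-- Backward uniqueness for the initial value problem. -/
theorem IsRealSolution.eq_zero {Q u u' : ℝ → ℝ} (hu : IsRealSolution Q u u')
    (hQ : ∀ a b, 0 < a → 0 < b → IntervalIntegrable Q volume a b) {a b : ℝ} (ha : 0 < a)
    (hab : a ≤ b) (h : u b = 0) (h' : u' b = 0) : u a = 0 ∧ u' a = 0 := by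
  have h1 := hu.energy_le hQ one_pos ha hab
  rw [h, h'] at h1
  simp only [ne_eq, OfNat.ofNat_ne_zero, not_false_eq_true, zero_pow, mul_zero, add_zero, zero_mul,
    one_pow, one_mul] at h1
  constructor <;> nlinarith [sq_nonneg (u a), sq_nonneg (u' a)]

theorem IsRegularWith.const_mul {l L : ℝ} {Q u u' : ℝ → ℝ} (h : IsRegularWith l Q L u u') (c : ℝ) :
    IsRegularWith l Q (c * L) (fun x => c * u x) (fun x => c * u' x) :=
  ⟨h.sol.const_mul c, (h.lim.const_mul c).congr fun x => by ring⟩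

section zeroEnergy

variable {l L : ℝ} {q u u' : ℝ → ℝ}

theorem MarchenkoClass.integrableOn_mul_Ioc (hq : MarchenkoClass q) (x : ℝ) (_ : 0 < x) :
    IntegrableOn (fun y => y * q y) (Ioc 0 x) :=
  hq.integrableOn_mul.mono_set Ioc_zero_subset

theorem MarchenkoClass.integral_Ioc_le (hq : MarchenkoClass q) (x : ℝ) :
    ∫ y in Ioc 0 x, |y * q y| ≤ ∫ y in Ioi 0, |y * q y| :=
  setIntegral_mono_set hq.integrableOn_mul.abs (ae_of_all _ fun _ => abs_nonneg _)
    Ioc_zero_subset.eventuallyLE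

theorem exists_bound_zeroEnergy (hl : 0 < 2 * l + 1) (hq : MarchenkoClass q)
    (h : IsRegularWith l q L u u') : ∃ C, 0 < C ∧ ∀ x, 0 < x → |x ^ (-l - 1) * u x| ≤ C := by
  refine ⟨2 * |L| * Real.exp (2 * ((2 * l + 1)⁻¹ * ∫ y in Ioi 0, |y * q y|)) + 1, by positivity,
    fun x hx => ?_⟩
  refine ((h.abs_le hl hq.integrableOn_mul_Ioc hx).trans ?_).trans (le_add_of_nonneg_right
    zero_le_one)
  rw [integral_const_mul]
  have := hq.integral_Ioc_le x
  have := inv_pos.2 hl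
  gcongr

theorem tendsto_atTop_zeroEnergy (hl : 0 < 2 * l + 1) (hq : MarchenkoClass q)
    (h : IsRegularWith l q L u u') :
    (∃ v, Tendsto (fun x => x ^ (-l - 1) * u x) atTop (𝓝 v)) ∧
    Tendsto (fun x => x ^ (-(2 * l + 1)) * (x ^ (l + 1) * u' x - (l + 1) * x ^ l * u x)) atTop
      (𝓝 0) := by
  obtain ⟨C, -, hC⟩ := exists_bound_zeroEnergy hl hq h
  have hb : IntegrableOn (fun y => y * q y * (y ^ (-l - 1) * u y)) (Ioi 0) :=
    integrableOn_mul_of_bdd measurableSet_Ioi Subset.rfl hq.integrableOn_mul h.continuousOn hC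
  have h2 := tendsto_rpow_neg_mul_integral_atTop hl hb
  refine ⟨⟨L + (2 * l + 1)⁻¹ * ((∫ y in Ioi 0, y * q y * (y ^ (-l - 1) * u y)) - 0), ?_⟩, ?_⟩
  · have h1 := intervalIntegral_tendsto_integral_Ioi 0 hb tendsto_id
    refine (((h1.sub h2).const_mul (2 * l + 1)⁻¹).const_add L).congr' ?_
    filter_upwards [eventually_gt_atTop 0] with x hx
    rw [(h.integral_eq hl hq.integrableOn_mul_Ioc hx).1, id,
      intervalIntegral.integral_of_le hx.le, radialPotential]
  · refine h2.congr' ?_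
    filter_upwards [eventually_gt_atTop 0] with x hx
    rw [(h.integral_eq hl hq.integrableOn_mul_Ioc hx).2]

/-- The subdominant zero energy solution, which behaves like `x^{-l}` at infinity. -/
theorem exists_subdominant_solution (hl : 0 < 2 * l + 1) (hq : MarchenkoClass q) :
    ∃ g g', IsRealSolution (fun x => centrifugal l x + q x) g g' ∧
      Tendsto (fun x => x ^ l * g x) atTop (𝓝 1) ∧
      Tendsto (fun x => x ^ (l + 1) * g' x) atTop (𝓝 (-l)) := by
  have hqi : ∀ x, 0 < x → IntegrableOn (fun y => y * q y) (Ioi x) := fun x hx =>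
    hq.integrableOn_mul.mono_set (Ioi_subset_Ioi_zero hx)
  have hle : ∀ x y : ℝ, 0 < x → y ∈ Ioi x → x ^ (2 * l + 1) * y ^ (-(2 * l + 1)) ≤ 1 := by
    intro x y hx hy
    have := rpow_neg_mul_rpow_le_one hl (x := y) (y := x) ⟨hx, le_of_lt hy⟩
    rwa [mul_comm]
  have hnn : ∀ x y : ℝ, 0 < x → y ∈ Ioi x → 0 ≤ x ^ (2 * l + 1) * y ^ (-(2 * l + 1)) :=
    fun x y hx hy => mul_nonneg (Real.rpow_nonneg hx.le _)
      (Real.rpow_nonneg (hx.trans hy).le _)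
  have hInt : ∀ (b : ℝ → ℝ) (x : ℝ), 0 < x → IntegrableOn b (Ioi x) →
      IntegrableOn (fun y => y ^ (-(2 * l + 1)) * b y) (Ioi x) := by
    intro b x hx hb
    refine (integrableOn_mul_of_bdd measurableSet_Ioi (Ioi_subset_Ioi_zero hx) hb
      (continuousOn_rpow_Ioi (-(2 * l + 1))) (c := x ^ (-(2 * l + 1))) fun y hy => ?_).congr_fun
      (fun y _ => mul_comm _ _) measurableSet_Ioi
    rw [abs_of_nonneg (Real.rpow_nonneg (hx.trans hy).le _)]
    exact Real.rpow_le_rpow_of_nonpos hx (le_of_lt hy) (by linarith)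
  obtain ⟨w, -, -, hi₁, -, hw⟩ := exists_volterra_solution_Ioi
    (κ := fun y => (2 * l + 1)⁻¹ * |y * q y|) (u₀ := fun _ => 1) (a₁ := fun _ => (2 * l + 1)⁻¹)
    (a₂ := fun x => -((2 * l + 1)⁻¹ * x ^ (2 * l + 1))) (b₁ := fun y => y * q y)
    (b₂ := fun y => y ^ (-(2 * l + 1)) * (y * q y)) (fun x hx => (hqi x hx).abs.const_mul _)
    (fun x _ => mul_nonneg (inv_pos.2 hl).le (abs_nonneg _)) continuousOn_const
    (fun _ _ => by simp) continuousOn_const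
    (continuousOn_const.mul (continuousOn_rpow_Ioi _)).neg hqi
    (fun x hx => hInt _ x hx (hqi x hx)) (fun x hx y hy => by
      have h1 : (2 * l + 1)⁻¹ * (y * q y) + -((2 * l + 1)⁻¹ * x ^ (2 * l + 1)) *
          (y ^ (-(2 * l + 1)) * (y * q y)) = (2 * l + 1)⁻¹ *
          ((1 - x ^ (2 * l + 1) * y ^ (-(2 * l + 1))) * (y * q y)) := by ring
      have h2 := hle x y hx hy
      have h3 := hnn x y hx hy
      rw [h1, abs_mul, abs_of_pos (inv_pos.2 hl)]
      refine mul_le_mul_of_nonneg_left ?_ (inv_pos.2 hl).le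
      rw [abs_mul, abs_of_nonneg (by linarith)]
      exact mul_le_of_le_one_left (abs_nonneg _) (by linarith))
  set s := 2 * l + 1 with hs
  have hi₂ := fun x hx => hInt _ x hx (hi₁ x hx)
  set A : ℝ → ℝ := fun x => 1 + s⁻¹ * ∫ y in Ioi x, y * q y * w y with hA
  set B : ℝ → ℝ := fun x => -s⁻¹ * ∫ y in Ioi x, y ^ (-s) * (y * q y * w y) with hB
  have hw' : ∀ x, 0 < x → w x = A x + B x * x ^ s := by
    intro x hx
    rw [hw x hx, hA, hB]
    simp only [mul_assoc]
    ring
  have hp : IsRealSolution (centrifugal l) (fun x => x ^ (l + 1)) (fun x => (l + 1) * x ^ l) := by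
    simpa using isRealSolution_rpow (l := l) (p := l + 1) (by ring)
  have hm : IsRealSolution (centrifugal l) (fun x => x ^ (-l)) (fun x => -l * x ^ (-l - 1)) :=
    isRealSolution_rpow (by ring)
  have hAlim : Tendsto A atTop (𝓝 1) := by
    simpa using ((tendsto_integral_Ioi_atTop (hi₁ 1 one_pos)).const_mul s⁻¹).const_add 1
  have hBlim : Tendsto (fun x => B x * x ^ s) atTop (𝓝 0) := by
    have h1 : Tendsto (fun x => s⁻¹ * ∫ y in Ioi x, |y * q y * w y|) atTop (𝓝 0) := by
      simpa using (tendsto_integral_Ioi_atTop (hi₁ 1 one_pos).abs).const_mul s⁻¹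
    refine squeeze_zero_norm' ?_ h1
    filter_upwards [eventually_gt_atTop 0] with x hx
    have h2 : B x * x ^ s = -s⁻¹ * ∫ y in Ioi x, x ^ s * (y ^ (-s) * (y * q y * w y)) := by
      rw [integral_const_mul, hB]; ring
    rw [h2, norm_mul, norm_neg, Real.norm_of_nonneg (inv_pos.2 hl).le]
    refine mul_le_mul_of_nonneg_left ?_ (inv_pos.2 hl).le
    refine norm_integral_le_of_norm_le (hi₁ x hx).abs ?_
    refine (ae_restrict_iff' measurableSet_Ioi).2 (ae_of_all _ fun y hy => ?_)
    rw [Real.norm_eq_abs, ← mul_assoc, abs_mul, abs_of_nonneg (hnn x y hx hy)]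
    exact mul_le_of_le_one_left (abs_nonneg _) (hle x y hx hy)
  have hpow : ∀ x : ℝ, 0 < x → x ^ l * x ^ (-l) = 1 := fun x hx => by
    rw [← Real.rpow_add hx]; simp
  have hpow' : ∀ x : ℝ, 0 < x → x ^ (l + 1) * x ^ (-l - 1) = 1 := fun x hx => by
    rw [← Real.rpow_add hx]; simp
  refine ⟨fun x => x ^ (-l) * w x, _, .of_variation hm hp
    (((hasWeakDeriv_integral_Ioi hi₁).const_mul s⁻¹).const_add 1)
    ((hasWeakDeriv_integral_Ioi hi₂).const_mul (-s⁻¹)) (fun x hx => ?_) (fun x hx => ?_)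
    (fun x hx => ?_), ?_, ?_⟩
  · have h1 : x ^ (l + 1) = x ^ s * x ^ (-l) := by
      rw [← Real.rpow_add hx]; congr 1; rw [hs]; ring
    rw [hw' x hx, h1]
    ring
  · have h1 : x ^ (-l) = x ^ (-s) * x ^ (l + 1) := by
      rw [← Real.rpow_add hx]; congr 1; rw [hs]; ring
    rw [h1]; ring
  · have h1 : x ^ (-l - 1) = x ^ (-s) * x ^ l := by
      rw [← Real.rpow_add hx]; congr 1; rw [hs]; ring
    have h2 : x ^ (-l) = x ^ (-l - 1) * x := by
      rw [Real.rpow_sub_one hx.ne']; field_simp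
    rw [h2]
    have h3 : s⁻¹ * s = 1 := inv_mul_cancel₀ hl.ne'
    linear_combination (-(s⁻¹ * (l + 1) * x * q x * w x)) * h1
      + (x * q x * w x * x ^ (-l - 1)) * h3 + (-(s⁻¹ * x * q x * w x * x ^ (-l - 1))) * hs
  · have h1 := hAlim.add hBlim
    rw [add_zero] at h1
    refine h1.congr' ?_
    filter_upwards [eventually_gt_atTop 0] with x hx
    rw [← hw' x hx, ← mul_assoc, hpow x hx, one_mul]
  · have h1 := (hAlim.mul_const (-l)).add (hBlim.mul_const (l + 1))
    rw [one_mul, zero_mul, add_zero] at h1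
    refine h1.congr' ?_
    filter_upwards [eventually_gt_atTop 0] with x hx
    have h2 : x ^ (l + 1) * x ^ l = x ^ s := by
      rw [← Real.rpow_add hx]; congr 1; rw [hs]; ring
    change A x * -l + B x * x ^ s * (l + 1)
      = x ^ (l + 1) * (A x * (-l * x ^ (-l - 1)) + B x * ((l + 1) * x ^ l))
    linear_combination (A x * l) * hpow' x hx - (B x * (l + 1)) * h2

/-- In the resonant case the regular zero energy solution is of size `x^{-l}`. -/
theorem exists_resonant_bounds (hl : 0 < 2 * l + 1) (hq : MarchenkoClass q)
    (h : IsRegularWith l q L u u') (hL : L ≠ 0)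
    (hres : Tendsto (fun x => x ^ (-l - 1) * u x) atTop (𝓝 0)) :
    ∃ R c C : ℝ, 1 ≤ R ∧ 0 < c ∧ 0 < C ∧ (∀ x, R ≤ x → c * x ^ (-l) ≤ |u x|) ∧
      (∀ x, 0 < x → |u x| ≤ C * x ^ (-l)) ∧ ∀ x, R ≤ x → |u' x| ≤ C * x ^ (-l - 1) := by
  obtain ⟨g, g', hg, hg1, hg2⟩ := exists_subdominant_solution hl hq
  obtain ⟨V, hV0, hV⟩ := exists_bound_zeroEnergy hl hq h
  have hQ : ∀ a b, 0 < a → 0 < b →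
      IntervalIntegrable (fun x => centrifugal l x + q x) volume a b := fun a b ha hb => by
    simpa using intervalIntegrable_potential hq l 0 a b ha hb
  have hWc : HasWeakDeriv (fun x => g x * u' x - g' x * u x) (fun _ => 0) :=
    (hg.wronskian h.sol).congr (fun _ _ => rfl) fun x _ => by ring
  have hWlim : Tendsto (fun x => g x * u' x - g' x * u x) atTop (𝓝 0) := by
    have h1 := (hg1.mul ((tendsto_atTop_zeroEnergy hl hq h).2.add (hres.const_mul (l + 1)))).sub
      (hg2.mul hres)
    simp only [mul_zero, add_zero, sub_zero] at h1
    refine h1.congr' ?_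
    filter_upwards [eventually_gt_atTop 0] with x hx
    have e1 : x ^ l * (x ^ (-(2 * l + 1)) * x ^ (l + 1)) = 1 := by
      rw [← Real.rpow_add hx, ← Real.rpow_add hx]
      ring_nf
      simp
    have e2 : x ^ l * (x ^ (-(2 * l + 1)) * x ^ l) = x ^ l * x ^ (-l - 1) := by
      rw [← Real.rpow_add hx]
      ring_nf
    have e3 : x ^ (l + 1) * x ^ (-l - 1) = 1 := by rw [← Real.rpow_add hx]; simp
    linear_combination (g x * u' x) * e1 - (g x * (l + 1) * u x) * e2 - (g' x * u x) * e3
  have hW : ∀ x, 0 < x → g x * u' x - g' x * u x = 0 := fun x hx =>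
    tendsto_nhds_unique (tendsto_const_nhds.congr' (by
      filter_upwards [eventually_gt_atTop 0] with y hy using hWc.eq_of_deriv_zero hx hy)) hWlim
  obtain ⟨R, hR⟩ := eventually_atTop.1 ((eventually_ge_atTop (1 : ℝ)).and
    ((hg1.eventually_const_lt (show (1 / 2 : ℝ) < 1 by norm_num)).and
    ((hg1.eventually_lt_const (show (1 : ℝ) < 2 by norm_num)).and
      (hg2.abs.eventually_lt_const (lt_add_one |-l|)))))
  have hR1 : 1 ≤ R := (hR R le_rfl).1
  have hR0 : 0 < R := one_pos.trans_le hR1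
  have hgpos : ∀ x, R ≤ x → 0 < g x := fun x hx => by
    have h1 := (hR x hx).2.1
    have h2 := Real.rpow_pos_of_pos (hR0.trans_le hx) l
    exact pos_of_mul_pos_right (by linarith) h2.le
  have hprop : ∀ b, R ≤ b → ∀ x, 0 < x → x ≤ b →
      u x - u b / g b * g x = 0 ∧ u' x - u b / g b * g' x = 0 := by
    intro b hb x hx hxb
    have hgb := (hgpos b hb).ne'
    refine (h.sol.sub (hg.const_mul (u b / g b))).eq_zero hQ hx hxb ?_ ?_
    · field_simp; ring
    · have := hW b (hR0.trans_le hb)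
      field_simp
      linarith
  set c := u R / g R with hc
  have hcu : ∀ x, 0 < x → u x = c * g x ∧ u' x = c * g' x := by
    intro x hx
    have h1 := hprop (max x R) (le_max_right _ _) R hR0 (le_max_right _ _)
    have h2 := hprop (max x R) (le_max_right _ _) x hx (le_max_left _ _)
    have h3 : u (max x R) / g (max x R) = c := by
      rw [hc, eq_div_iff (hgpos R le_rfl).ne']
      linarith [h1.1]
    rw [h3] at h2
    constructor <;> linarith [h2.1, h2.2]
  have hc0 : c ≠ 0 := by
    intro h0
    apply hL
    refine tendsto_nhds_unique h.lim (tendsto_const_nhds.congr' ?_)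
    filter_upwards [self_mem_nhdsWithin] with x hx
    rw [(hcu x hx).1, h0]
    ring
  have hcp : 0 < |c| := abs_pos.2 hc0
  have hmul : ∀ x, 0 < x → x ^ (-l) * (x ^ l * g x) = g x := fun x hx => by
    rw [← mul_assoc, ← Real.rpow_add hx]; simp
  refine ⟨R, |c| * (1 / 2), |c| * 2 + V * R ^ (2 * l + 1) + |c| * (|-l| + 1), hR1, by positivity,
    by positivity, fun x hx => ?_, fun x hx => ?_, fun x hx => ?_⟩
  · have hx0 := hR0.trans_le hx
    rw [(hcu x hx0).1, abs_mul, abs_of_pos (hgpos x hx), mul_assoc, ← hmul x hx0]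
    have h1 := (hR x hx).2.1.le
    have h2 := Real.rpow_nonneg hx0.le (-l)
    refine mul_le_mul_of_nonneg_left ?_ hcp.le
    rw [mul_comm]
    exact mul_le_mul_of_nonneg_left h1 h2
  · have h2 := Real.rpow_pos_of_pos hx (-l)
    have hRs : 0 < V * R ^ (2 * l + 1) := by positivity
    have hlast : 0 < |c| * (|-l| + 1) := by positivity
    rcases le_total R x with hxR | hxR
    · have h1 : |u x| ≤ (|c| * 2) * x ^ (-l) := by
        rw [(hcu x hx).1, abs_mul, abs_of_pos (hgpos x hxR), ← hmul x hx]
        calc |c| * (x ^ (-l) * (x ^ l * g x)) ≤ |c| * (x ^ (-l) * 2) := by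
              have := (hR x hxR).2.2.1.le
              gcongr
          _ = _ := by ring
      refine h1.trans (mul_le_mul_of_nonneg_right (by linarith) h2.le)
    · have h1 : |u x| ≤ (V * R ^ (2 * l + 1)) * x ^ (-l) := by
        have e1 : x ^ (l + 1) = x ^ (2 * l + 1) * x ^ (-l) := by
          rw [← Real.rpow_add hx]; ring_nf
        rw [IsRegularWith.eq_rpow_mul (l := l) u hx, abs_mul,
          abs_of_pos (Real.rpow_pos_of_pos hx _), e1]
        calc x ^ (2 * l + 1) * x ^ (-l) * |x ^ (-l - 1) * u x|
            ≤ R ^ (2 * l + 1) * x ^ (-l) * V := by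
              have := hV x hx
              have := Real.rpow_le_rpow hx.le hxR hl.le
              gcongr
          _ = _ := by ring
      refine h1.trans (mul_le_mul_of_nonneg_right ?_ h2.le)
      linarith
  · have hx0 := hR0.trans_le hx
    have h2 := Real.rpow_pos_of_pos hx0 (-l - 1)
    have hRs : 0 < V * R ^ (2 * l + 1) := by positivity
    have h1 : |u' x| ≤ (|c| * (|-l| + 1)) * x ^ (-l - 1) := by
      have e1 : g' x = x ^ (-l - 1) * (x ^ (l + 1) * g' x) := by
        rw [← mul_assoc, ← Real.rpow_add hx0]; simp
      rw [(hcu x hx0).2, e1, abs_mul, abs_mul, abs_of_pos h2]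
      calc |c| * (x ^ (-l - 1) * |x ^ (l + 1) * g' x|) ≤ |c| * (x ^ (-l - 1) * (|-l| + 1)) := by
            have := (hR x hx).2.2.2.le
            gcongr
        _ = _ := by ring
    refine h1.trans (mul_le_mul_of_nonneg_right ?_ h2.le)
    linarith

end zeroEnergy

/-! ### Low energy asymptotics -/

section lowEnergy

variable {l L k : ℝ} {q u u' u₀ u₀' : ℝ → ℝ}

theorem integrableOn_mul_self_mul (h₀ : IsRegularWith l q L u₀ u₀') (X : ℝ) :
    IntegrableOn (fun y => y * |y ^ (-l - 1) * u₀ y|) (Ioc 0 X) := by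
  obtain ⟨M, hM⟩ := exists_bound_Ioc h₀.continuousOn h₀.lim X
  have h1 : IntegrableOn (fun y : ℝ => y) (Ioc 0 X) :=
    continuous_id.integrableOn_Icc.mono_set Ioc_subset_Icc_self
  exact integrableOn_mul_of_bdd measurableSet_Ioc Ioc_zero_subset h1 h₀.continuousOn.abs
    fun y hy => (abs_abs _).trans_le (hM y hy)

/-- Comparison of the regular solutions at energies `k²` and `0`. -/
theorem abs_sub_zeroEnergy_le (hl : 0 < 2 * l + 1) (hq : MarchenkoClass q)
    (h₀ : IsRegularWith l q L u₀ u₀') (h : IsRegularWith l (fun x => q x - k ^ 2) L u u') {X : ℝ}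
    (hX : 0 < X) (hkX : k ^ 2 * X ^ 2 ≤ 1) {x : ℝ} (hx : x ∈ Ioc 0 X) :
    |x ^ (-l - 1) * u x - x ^ (-l - 1) * u₀ x| ≤
      2 * ((2 * l + 1)⁻¹ * (k ^ 2 * ∫ y in Ioc 0 X, y * |y ^ (-l - 1) * u₀ y|)) *
        Real.exp (2 * ((2 * l + 1)⁻¹ * ((∫ y in Ioi 0, |y * q y|) + 1))) := by
  set s := 2 * l + 1
  have hs := inv_pos.2 hl
  set v : ℝ → ℝ := fun x => x ^ (-l - 1) * u x with hv
  set v₀ : ℝ → ℝ := fun x => x ^ (-l - 1) * u₀ x with hv₀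
  set J := ∫ y in Ioc 0 X, y * |v₀ y| with hJ
  have hJ0 : 0 ≤ J := setIntegral_nonneg measurableSet_Ioc fun y hy =>
    mul_nonneg hy.1.le (abs_nonneg _)
  have hQ := hq.integrableOn_mul_sub (k ^ 2)
  obtain ⟨M, hM⟩ := exists_bound_Ioc (h.continuousOn.sub h₀.continuousOn) (h.lim.sub h₀.lim) X
  have hg := gronwall_Ioc (κ := fun y => s⁻¹ * |y * (q y - k ^ 2)|) (X := X) (M := M)
    (a := s⁻¹ * (k ^ 2 * J)) (θ := fun x => |v x - v₀ x|) (fun x hx => (hQ x hx).abs.const_mul _)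
    (fun x _ => mul_nonneg hs.le (abs_nonneg _)) (by positivity)
    (fun _ _ => abs_nonneg _) hM (fun y hy => ?_) hx
  · refine hg.trans (mul_le_mul_of_nonneg_left ?_ (by positivity))
    rw [Real.exp_le_exp, integral_const_mul]
    refine mul_le_mul_of_nonneg_left (mul_le_mul_of_nonneg_left ?_ hs.le) zero_le_two
    have hi1 : IntegrableOn (fun y => |y * q y|) (Ioc 0 x) :=
      (hq.integrableOn_mul_Ioc x hx.1).abs
    have hi2 : IntegrableOn (fun _ : ℝ => k ^ 2 * X) (Ioc 0 x) := integrableOn_const (by simp)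
    calc ∫ y in Ioc 0 x, |y * (q y - k ^ 2)|
        ≤ ∫ y in Ioc 0 x, (|y * q y| + k ^ 2 * X) := by
          refine setIntegral_mono_on (hQ x hx.1).abs (hi1.add hi2) measurableSet_Ioc
            fun y hy => ?_
          rw [mul_sub]
          refine (abs_sub _ _).trans (add_le_add_right ?_ _)
          rw [abs_of_nonneg (mul_nonneg hy.1.le (sq_nonneg k)), mul_comm]
          exact mul_le_mul_of_nonneg_left (hy.2.trans hx.2) (sq_nonneg k)
      _ = (∫ y in Ioc 0 x, |y * q y|) + x * (k ^ 2 * X) := by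
          rw [integral_add hi1 hi2, setIntegral_const]
          simp [hx.1.le]
      _ ≤ _ := by
          refine add_le_add (hq.integral_Ioc_le x) ?_
          calc x * (k ^ 2 * X) ≤ X * (k ^ 2 * X) := by
                have := hx.2
                gcongr
            _ = k ^ 2 * X ^ 2 := by ring
            _ ≤ 1 := hkX
  · have e1 := (h.integral_eq hl hQ hy.1).1
    have e2 := (h₀.integral_eq hl hq.integrableOn_mul_Ioc hy.1).1
    have hb := h.integrableOn hQ hy.1
    have hb₀ := h₀.integrableOn hq.integrableOn_mul_Ioc hy.1
    have e3 : v y - v₀ y = radialPotential s (fun t => t * (q t - k ^ 2) * (t ^ (-l - 1) * u t)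
        - t * q t * (t ^ (-l - 1) * u₀ t)) y := by
      rw [← radialPotential_sub hl hb hb₀]
      simp only [hv, hv₀]
      rw [e1, e2]
      ring
    have hi3 := integrableOn_mul_self_mul h₀ y
    have hi4 : IntegrableOn (fun t => |t * (q t - k ^ 2)| * |v t - v₀ t|) (Ioc 0 y) :=
      integrableOn_mul_of_bdd measurableSet_Ioc Ioc_zero_subset (hQ y hy.1).abs
        (h.continuousOn.sub h₀.continuousOn).abs (c := M)
        fun t ht => (abs_abs _).trans_le (hM t ⟨ht.1, ht.2.trans hy.2⟩)
    calc |v y - v₀ y| ≤ s⁻¹ * ∫ t in Ioc 0 y, |t * (q t - k ^ 2) * (t ^ (-l - 1) * u t)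
          - t * q t * (t ^ (-l - 1) * u₀ t)| := by
          rw [e3]; exact abs_radialPotential_le hl (hb.sub hb₀)
      _ ≤ s⁻¹ * ∫ t in Ioc 0 y, (k ^ 2 * (t * |v₀ t|) + |t * (q t - k ^ 2)| * |v t - v₀ t|) := by
          refine mul_le_mul_of_nonneg_left ?_ hs.le
          refine setIntegral_mono_on (hb.sub hb₀).abs ((hi3.const_mul _).add hi4)
            measurableSet_Ioc fun t ht => ?_
          have e4 : t * (q t - k ^ 2) * (t ^ (-l - 1) * u t) - t * q t * (t ^ (-l - 1) * u₀ t)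
              = t * (q t - k ^ 2) * (v t - v₀ t) - k ^ 2 * t * v₀ t := by
            simp only [hv, hv₀]; ring
          rw [e4]
          refine (abs_sub _ _).trans_eq ?_
          rw [abs_mul _ (v t - v₀ t), abs_mul (k ^ 2 * t),
            abs_of_nonneg (mul_nonneg (sq_nonneg k) ht.1.le)]
          ring
      _ = s⁻¹ * (k ^ 2 * ∫ t in Ioc 0 y, t * |v₀ t|)
          + ∫ t in Ioc 0 y, s⁻¹ * |t * (q t - k ^ 2)| * |v t - v₀ t| := by
          rw [integral_add (hi3.const_mul _) hi4, integral_const_mul, mul_add,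
            ← integral_const_mul s⁻¹]
          simp only [mul_assoc]
          rfl
      _ ≤ _ := by
          refine add_le_add_left (mul_le_mul_of_nonneg_left (mul_le_mul_of_nonneg_left ?_
            (sq_nonneg k)) hs.le) _
          exact setIntegral_mono_set (integrableOn_mul_self_mul h₀ X)
            ((ae_restrict_iff' measurableSet_Ioc).2 (ae_of_all _ fun t ht =>
              mul_nonneg ht.1.le (abs_nonneg _))) (Ioc_subset_Ioc_right hy.2).eventuallyLE

theorem IsRegularWith.exists_bound (hl : 0 < 2 * l + 1) {Q : ℝ → ℝ} (h : IsRegularWith l Q L u u')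
    (X : ℝ) : ∃ M, ∀ x ∈ Ioc 0 X, |u x| ≤ M := by
  obtain ⟨M, hM⟩ := exists_bound_Ioc h.continuousOn h.lim X
  refine ⟨X ^ (l + 1) * M, fun x hx => ?_⟩
  rw [eq_rpow_mul (l := l) u hx.1, abs_mul, abs_of_nonneg (Real.rpow_nonneg hx.1.le _)]
  exact mul_le_mul (Real.rpow_le_rpow hx.1.le hx.2 (by linarith)) (hM x hx) (abs_nonneg _)
    (Real.rpow_nonneg (hx.1.le.trans hx.2) _)

theorem integrableOn_mul_regular (hl : 0 < 2 * l + 1) {Q Q₀ : ℝ → ℝ}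
    (h : IsRegularWith l Q L u u') (h₀ : IsRegularWith l Q₀ L u₀ u₀') (X : ℝ) :
    IntegrableOn (fun x => u₀ x * u x) (Ioc 0 X) := by
  obtain ⟨M, hM⟩ := h.exists_bound hl X
  obtain ⟨M₀, hM₀⟩ := h₀.exists_bound hl X
  have h1 : IntegrableOn (fun _ : ℝ => (1 : ℝ)) (Ioc 0 X) := integrableOn_const (by simp)
  have h2 := integrableOn_mul_of_bdd measurableSet_Ioc Ioc_zero_subset h1 h₀.sol.continuousOn hM₀
  have h3 := integrableOn_mul_of_bdd measurableSet_Ioc Ioc_zero_subset h2 h.sol.continuousOn hM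
  simpa using h3

/-- The Wronskian of the regular solutions at energies `0` and `k²`. -/
theorem wronskian_zeroEnergy (hl : 0 < 2 * l + 1) (hq : MarchenkoClass q)
    (h₀ : IsRegularWith l q L u₀ u₀') (h : IsRegularWith l (fun x => q x - k ^ 2) L u u') {X : ℝ}
    (hX : 0 < X) :
    u₀ X * u' X - u₀' X * u X = -(k ^ 2 * ∫ y in Ioc 0 X, u₀ y * u y) := by
  have hQ := hq.integrableOn_mul_sub (k ^ 2)
  have hi := fun x (_ : 0 < x) => integrableOn_mul_regular hl h h₀ x
  have hD : HasWeakDeriv (fun x => (u₀ x * u' x - u₀' x * u x)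
      + k ^ 2 * ∫ y in Ioc 0 x, u₀ y * u y) (fun _ => 0) :=
    ((h₀.sol.wronskian h.sol).add ((hasWeakDeriv_integral_Ioc hi).const_mul (k ^ 2))).congr
      (fun _ _ => rfl) fun x _ => by ring
  have hβ : Tendsto (fun x => x ^ (l + 1) * u' x - (l + 1) * x ^ l * u x) (𝓝[>] 0) (𝓝 0) := by
    refine (tendsto_integral_Ioc_zero hX (integrableOn_rpow_mul hl
      (h.integrableOn hQ hX))).congr' ?_
    filter_upwards [self_mem_nhdsWithin] with x hx using (h.integral_eq hl hQ hx).2.symm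
  have hβ₀ : Tendsto (fun x => x ^ (l + 1) * u₀' x - (l + 1) * x ^ l * u₀ x) (𝓝[>] 0) (𝓝 0) := by
    refine (tendsto_integral_Ioc_zero hX (integrableOn_rpow_mul hl
      (h₀.integrableOn hq.integrableOn_mul_Ioc hX))).congr' ?_
    filter_upwards [self_mem_nhdsWithin] with x hx
      using (h₀.integral_eq hl hq.integrableOn_mul_Ioc hx).2.symm
  have hlim := ((h₀.lim.mul hβ).sub (h.lim.mul hβ₀)).add
    ((tendsto_integral_Ioc_zero hX (hi X hX)).const_mul (k ^ 2))
  have hc := tendsto_nhds_unique (hlim.congr' (f₂ := fun _ => (u₀ X * u' X - u₀' X * u X)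
      + k ^ 2 * ∫ y in Ioc 0 X, u₀ y * u y) (by
    filter_upwards [self_mem_nhdsWithin] with x hx
    have hx : 0 < x := hx
    have e : x ^ (-l - 1) * x ^ (l + 1) = 1 := by rw [← Real.rpow_add hx]; simp
    rw [← hD.eq_of_deriv_zero hx hX]
    linear_combination (u₀ x * u' x - u₀' x * u x) * e)) tendsto_const_nhds
  simp only [mul_zero, sub_zero, add_zero] at hc
  linarith

end lowEnergy

/-! ### Lower bounds for the Jost function -/

theorem norm_normalizedJostFunction (l : ℝ) (q : ℝ → ℝ) (k : ℝ) :
    ‖normalizedJostFunction l q k‖ = |k| ^ l * ‖jostFunction l q k‖ := by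
  have h : -(Complex.I * (Real.pi * l / 2)) = ((-(Real.pi * l / 2) : ℝ) : ℂ) * Complex.I := by
    push_cast; ring
  rw [normalizedJostFunction, norm_mul, norm_mul, h, Complex.norm_exp_ofReal_mul_I, one_mul,
    Complex.norm_cpow_real, Complex.norm_real, Real.norm_eq_abs]

theorem normalizedJostFunction_ne_zero {l : ℝ} {q : ℝ → ℝ} (hl : 0 < 2 * l + 1)
    (hq : MarchenkoClass q) {k : ℝ} (hk : k ≠ 0) : normalizedJostFunction l q k ≠ 0 := by
  rw [← norm_ne_zero_iff, norm_normalizedJostFunction]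
  refine mul_ne_zero (Real.rpow_pos_of_pos (abs_pos.2 hk) l).ne' fun h0 => ?_
  obtain ⟨u, u', hu, hE⟩ := exists_regular_energy_le hl hq hk
  refine (regularConst_pos hl).ne' (tendsto_nhds_unique hu.lim (tendsto_const_nhds.congr' ?_))
  filter_upwards [self_mem_nhdsWithin] with x hx
  have h1 := hE x hx
  rw [h0] at h1
  have h2 : 0 < k ^ 2 := by positivity
  have h3 : u x ^ 2 = 0 := by
    refine le_antisymm ?_ (sq_nonneg _)
    by_contra! h4
    have := mul_pos h2 h4
    simp only [ne_eq, OfNat.ofNat_ne_zero, not_false_eq_true, zero_pow, mul_zero, zero_mul] at h1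
    linarith [sq_nonneg (u' x)]
  rw [pow_eq_zero_iff two_ne_zero] at h3
  rw [h3, mul_zero]

theorem integral_potential_le {q : ℝ → ℝ} (hq : MarchenkoClass q) (l : ℝ) {X : ℝ} (hX : 0 < X) :
    ∫ y in Ioi X, |centrifugal l y + q y| ≤
      (|l * (l + 1)| + ∫ y in Ioi 0, |y * q y|) / X := by
  have h1 : IntegrableOn (fun y : ℝ => |l * (l + 1)| * y ^ (-2 : ℝ)) (Ioi X) :=
    (integrableOn_Ioi_rpow_of_lt (by norm_num) hX).const_mul _
  have h2 : IntegrableOn (fun y => X⁻¹ * |y * q y|) (Ioi X) :=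
    (hq.integrableOn_mul.mono_set (Ioi_subset_Ioi_zero hX)).abs.const_mul _
  calc ∫ y in Ioi X, |centrifugal l y + q y|
      ≤ ∫ y in Ioi X, (|l * (l + 1)| * y ^ (-2 : ℝ) + X⁻¹ * |y * q y|) := by
        refine setIntegral_mono_on (integrableOn_potential hq l hX).abs (h1.add h2)
          measurableSet_Ioi fun y hy => ?_
        have hy0 : 0 < y := hX.trans hy
        refine (abs_add_le _ _).trans (add_le_add (le_of_eq ?_) ?_)
        · rw [centrifugal, abs_div, abs_of_pos (pow_pos hy0 2), Real.rpow_neg hy0.le,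
            div_eq_mul_inv]
          norm_num
        · rw [abs_mul, abs_of_pos hy0, ← mul_assoc]
          refine le_mul_of_one_le_left (abs_nonneg _) ?_
          rw [inv_mul_eq_div, one_le_div hX]
          exact le_of_lt hy
    _ = |l * (l + 1)| * X⁻¹ + X⁻¹ * ∫ y in Ioi X, |y * q y| := by
        rw [integral_add h1 h2, integral_const_mul, integral_const_mul,
          integral_Ioi_rpow_of_lt (by norm_num) hX]
        norm_num
        left
        exact Real.rpow_neg_one X
    _ ≤ _ := by
        rw [add_div, ← div_eq_mul_inv, inv_mul_eq_div]
        refine add_le_add_right (div_le_div_of_nonneg_right ?_ hX.le) _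
        exact setIntegral_mono_set hq.integrableOn_mul.abs (ae_of_all _ fun _ => abs_nonneg _)
          (Ioi_subset_Ioi_zero hX).eventuallyLE

/-- At the point `A / |k|` the regular solution is controlled by the Jost function, uniformly
in `k`. -/
theorem exists_regular_abs_le {l : ℝ} {q : ℝ → ℝ} (hl : 0 < 2 * l + 1) (hq : MarchenkoClass q)
    {A : ℝ} (hA : 0 < A) :
    ∃ K, 0 < K ∧ ∀ k : ℝ, k ≠ 0 →
      ∃ u u', IsRegularWith l (fun x => q x - k ^ 2) (regularConst l) u u' ∧
        |u' (A / |k|)| ≤ K * ‖jostFunction l q k‖ ∧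
        |k| * |u (A / |k|)| ≤ K * ‖jostFunction l q k‖ := by
  set D := |l * (l + 1)| + ∫ y in Ioi 0, |y * q y| with hD
  refine ⟨√(8 * Real.exp (2 * (D / A))), by positivity, fun k hk => ?_⟩
  obtain ⟨u, u', hu, hE⟩ := exists_regular_energy_le hl hq hk
  have hk' : 0 < |k| := abs_pos.2 hk
  have hX : 0 < A / |k| := by positivity
  have h1 := hE _ hX
  have h2 : ∫ y in Ioi (A / |k|), |centrifugal l y + q y| / |k| ≤ D / A := by
    rw [integral_div]
    have h3 := div_le_div_of_nonneg_right (integral_potential_le hq l hX) hk'.le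
    refine h3.trans_eq ?_
    rw [← hD]
    field_simp
  have h3 : u' (A / |k|) ^ 2 + k ^ 2 * u (A / |k|) ^ 2 ≤
      (√(8 * Real.exp (2 * (D / A))) * ‖jostFunction l q k‖) ^ 2 := by
    rw [mul_pow, Real.sq_sqrt (by positivity)]
    refine h1.trans ?_
    calc 8 * ‖jostFunction l q k‖ ^ 2 *
          Real.exp (2 * ∫ y in Ioi (A / |k|), |centrifugal l y + q y| / |k|)
        ≤ 8 * ‖jostFunction l q k‖ ^ 2 * Real.exp (2 * (D / A)) := by gcongr
      _ = _ := by ring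
  refine ⟨u, u', hu, abs_le_of_sq_le_sq ?_ (by positivity), ?_⟩
  · exact le_trans (le_add_of_nonneg_right (by positivity)) h3
  · rw [← abs_mul]
    refine abs_le_of_sq_le_sq ?_ (by positivity)
    rw [mul_pow]
    exact le_trans (le_add_of_nonneg_left (by positivity)) h3

theorem tendsto_div_abs_atTop {A : ℝ} (hA : 0 < A) :
    Tendsto (fun k : ℝ => A / |k|) (𝓝[≠] 0) atTop := by
  simp only [div_eq_mul_inv]
  refine Tendsto.const_mul_atTop hA (tendsto_inv_nhdsGT_zero.comp ?_)
  refine tendsto_nhdsWithin_iff.2 ⟨?_, ?_⟩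
  · have := (continuous_abs.tendsto (0 : ℝ)).mono_left (nhdsWithin_le_nhds (s := {0}ᶜ))
    simpa using this
  · filter_upwards [self_mem_nhdsWithin] with k hk using abs_pos.2 hk

theorem eventually_abs_le_one : ∀ᶠ k : ℝ in 𝓝[≠] 0, |k| ≤ 1 := by
  have := (continuous_abs.tendsto (0 : ℝ)).mono_left (nhdsWithin_le_nhds (s := {0}ᶜ))
  rw [abs_zero] at this
  filter_upwards [this.eventually_lt_const one_pos] with k hk using hk.le

theorem sq_mul_div_abs_sq {k : ℝ} (hk : k ≠ 0) (A : ℝ) : k ^ 2 * (A / |k|) ^ 2 = A ^ 2 := by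
  rw [div_pow, sq_abs]; field_simp

/-- The lower bound for the Jost function without a zero energy resonance. -/
theorem exists_lower_bound_of_ne_zero {l v : ℝ} {q u₀ u₀' : ℝ → ℝ} (hl : 0 < 2 * l + 1)
    (hq : MarchenkoClass q) (h₀ : IsRegularWith l q (regularConst l) u₀ u₀')
    (hv : Tendsto (fun x => x ^ (-l - 1) * u₀ x) atTop (𝓝 v)) (hv0 : v ≠ 0) :
    ∃ c, 0 < c ∧ ∀ᶠ k : ℝ in 𝓝[≠] 0, c ≤ ‖normalizedJostFunction l q k‖ := by
  obtain ⟨V, hV0, hV⟩ := exists_bound_zeroEnergy hl hq h₀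
  set E := Real.exp (2 * ((2 * l + 1)⁻¹ * ((∫ y in Ioi 0, |y * q y|) + 1)))
  have hs := inv_pos.2 hl
  have hva : 0 < |v| := abs_pos.2 hv0
  set T := 2 * ((2 * l + 1)⁻¹ * V) * E with hT
  have hT0 : 0 < T := by positivity
  set A := min 1 (|v| / 4 / T) with hA
  have hA0 : 0 < A := lt_min one_pos (by positivity)
  have hA1 : A ^ 2 ≤ A := by
    rw [sq]; exact mul_le_of_le_one_left hA0.le (min_le_left _ _)
  have hAT : A ^ 2 * T ≤ |v| / 4 := by
    rw [← le_div_iff₀ hT0]; exact hA1.trans (min_le_right _ _)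
  obtain ⟨K, hK, hKu⟩ := exists_regular_abs_le hl hq hA0
  refine ⟨A * A ^ l * (|v| / 4) / K, by positivity, ?_⟩
  filter_upwards [self_mem_nhdsWithin, (tendsto_div_abs_atTop hA0).eventually
    (hv.abs.eventually_const_lt (show |v| / 2 < |v| by linarith))] with k hk hvX
  have hk : k ≠ 0 := hk
  have hk' : 0 < |k| := abs_pos.2 hk
  obtain ⟨u, u', hu, -, hub⟩ := hKu k hk
  set X := A / |k| with hXd
  have hX : 0 < X := by positivity
  have hkX : k ^ 2 * X ^ 2 = A ^ 2 := sq_mul_div_abs_sq hk A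
  have hd := abs_sub_zeroEnergy_le hl hq h₀ hu hX
    (hkX.trans_le (hA1.trans (min_le_left _ _))) ⟨hX, le_rfl⟩
  have hJ : ∫ y in Ioc 0 X, y * |y ^ (-l - 1) * u₀ y| ≤ X ^ 2 * V := by
    have h1 : IntegrableOn (fun _ : ℝ => X * V) (Ioc 0 X) := integrableOn_const (by simp)
    refine (setIntegral_mono_on (integrableOn_mul_self_mul h₀ X) h1 measurableSet_Ioc
      fun y hy => mul_le_mul hy.2 (hV y hy.1) (abs_nonneg _) hX.le).trans_eq ?_
    rw [setIntegral_const]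
    simp [hX.le]
    ring
  have hd2 : |X ^ (-l - 1) * u X - X ^ (-l - 1) * u₀ X| ≤ |v| / 4 := by
    refine hd.trans (le_trans ?_ hAT)
    calc _ ≤ 2 * ((2 * l + 1)⁻¹ * (k ^ 2 * (X ^ 2 * V))) * E := by gcongr
      _ = A ^ 2 * T := by rw [hT, ← hkX]; ring
  have hvk : |v| / 4 ≤ |X ^ (-l - 1) * u X| := by
    have := abs_sub_abs_le_abs_sub (X ^ (-l - 1) * u₀ X) (X ^ (-l - 1) * u X)
    rw [abs_sub_comm] at this
    linarith
  have huX : A * X ^ l * (|v| / 4) ≤ |k| * |u X| := by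
    rw [IsRegularWith.eq_rpow_mul (l := l) u hX, abs_mul, abs_of_pos (Real.rpow_pos_of_pos hX _),
      Real.rpow_add_one hX.ne']
    have h1 : |k| * X = A := by rw [hXd]; field_simp
    calc A * X ^ l * (|v| / 4) ≤ A * X ^ l * |X ^ (-l - 1) * u X| := by gcongr
      _ = _ := by rw [← h1]; ring
  rw [norm_normalizedJostFunction, div_le_iff₀ hK]
  have h2 : |k| ^ l * X ^ l = A ^ l := by
    rw [← Real.mul_rpow hk'.le hX.le, hXd]
    congr 1
    field_simp
  calc A * A ^ l * (|v| / 4) = |k| ^ l * (A * X ^ l * (|v| / 4)) := by rw [← h2]; ring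
    _ ≤ |k| ^ l * (K * ‖jostFunction l q k‖) := by
        have := huX.trans hub
        gcongr
    _ = _ := by ring

/-- The lower bound for the Jost function in the presence of a zero energy resonance. -/
theorem exists_lower_bound_of_resonant {l : ℝ} {q u₀ u₀' : ℝ → ℝ} (hl : 0 < 2 * l + 1)
    (hq : MarchenkoClass q) (h₀ : IsRegularWith l q (regularConst l) u₀ u₀')
    (hv : Tendsto (fun x => x ^ (-l - 1) * u₀ x) atTop (𝓝 0)) :
    ∃ c A n R d, 0 < c ∧ 0 < A ∧ 0 < n ∧ 1 ≤ R ∧ 0 < d ∧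
      (∀ X, 2 * R ≤ X → n ≤ ∫ y in Ioc 0 X, u₀ y * u₀ y) ∧
      (∀ x, R ≤ x → d * x ^ (-l) ≤ |u₀ x|) ∧
      ∀ᶠ k : ℝ in 𝓝[≠] 0, c * (k ^ 2 * ∫ y in Ioc 0 (A / |k|), u₀ y * u₀ y)
        ≤ ‖normalizedJostFunction l q k‖ := by
  obtain ⟨R, d, C, hR1, hd0, hC0, hlow, hup, hup'⟩ :=
    exists_resonant_bounds hl hq h₀ (regularConst_pos hl).ne' hv
  have hR0 : 0 < R := one_pos.trans_le hR1
  set E := Real.exp (2 * ((2 * l + 1)⁻¹ * ((∫ y in Ioi 0, |y * q y|) + 1))) with hE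
  have hs := inv_pos.2 hl
  set N : ℝ → ℝ := fun X => ∫ y in Ioc 0 X, u₀ y * u₀ y with hN
  set J : ℝ → ℝ := fun X => ∫ y in Ioc 0 X, y * |y ^ (-l - 1) * u₀ y| with hJ
  have hNi := fun X => integrableOn_mul_regular hl h₀ h₀ X
  have hJi := fun X => integrableOn_mul_self_mul h₀ X
  have hJ0 : ∀ X, 0 ≤ J X := fun X => setIntegral_nonneg measurableSet_Ioc fun y hy =>
    mul_nonneg hy.1.le (abs_nonneg _)
  have hupos : ∀ x, R ≤ x → 0 < |u₀ x| := fun x hx =>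
    lt_of_lt_of_le (mul_pos hd0 (Real.rpow_pos_of_pos (hR0.trans_le hx) _)) (hlow x hx)
  have hNmono : ∀ X Y, X ≤ Y → N X ≤ N Y := fun X Y h =>
    setIntegral_mono_set (hNi Y) (ae_of_all _ fun y => mul_self_nonneg _)
      (Ioc_subset_Ioc_right h).eventuallyLE
  have hn : 0 < N (2 * R) := by
    have h1 : 0 < ∫ y in R..(2 * R), u₀ y * u₀ y := by
      refine intervalIntegral.intervalIntegral_pos_of_pos_on ?_ (fun x hx => ?_) (by linarith)
      · rw [intervalIntegrable_iff_integrableOn_Ioc_of_le (by linarith)]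
        exact (hNi (2 * R)).mono_set (Ioc_subset_Ioc_left hR0.le)
      · exact mul_self_pos.2 (abs_pos.1 (hupos x hx.1.le))
    rw [intervalIntegral.integral_of_le (by linarith)] at h1
    exact h1.trans_le (setIntegral_mono_set (hNi _) (ae_of_all _ fun y => mul_self_nonneg _)
      (Ioc_subset_Ioc_left hR0.le).eventuallyLE)
  set n := N (2 * R) with hnd
  set c₃ := J R / n + d⁻¹ with hc₃
  have hc₃0 : 0 < c₃ := add_pos_of_nonneg_of_pos (div_nonneg (hJ0 R) hn.le) (inv_pos.2 hd0)
  have hJN : ∀ X, 2 * R ≤ X → J X ≤ c₃ * N X := by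
    intro X hX
    have hRX : R ≤ X := by linarith
    have e1 : J X = J R + ∫ y in Ioc R X, y * |y ^ (-l - 1) * u₀ y| := by
      rw [hJ]
      simp only
      rw [← setIntegral_union (Set.disjoint_left.2 fun y hy hy' => not_lt.2 hy.2 hy'.1)
        measurableSet_Ioc (hJi R) ((hJi X).mono_set (Ioc_subset_Ioc_left hR0.le)),
        Ioc_union_Ioc_eq_Ioc hR0.le hRX]
    have e2 : ∫ y in Ioc R X, y * |y ^ (-l - 1) * u₀ y| ≤ d⁻¹ * N X := by
      have h1 : ∫ y in Ioc R X, y * |y ^ (-l - 1) * u₀ y| ≤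
          ∫ y in Ioc R X, d⁻¹ * (u₀ y * u₀ y) := by
        refine setIntegral_mono_on ((hJi X).mono_set (Ioc_subset_Ioc_left hR0.le))
          (((hNi X).mono_set (Ioc_subset_Ioc_left hR0.le)).const_mul _) measurableSet_Ioc
          fun y hy => ?_
        have hy0 : 0 < y := hR0.trans hy.1
        have h2 := hlow y hy.1.le
        have h3 : y * y ^ (-l - 1) = y ^ (-l) := by
          rw [Real.rpow_sub_one hy0.ne']; field_simp
        rw [abs_mul, abs_of_pos (Real.rpow_pos_of_pos hy0 _), ← mul_assoc, h3,
          ← abs_mul_abs_self (u₀ y), ← mul_assoc]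
        refine mul_le_mul_of_nonneg_right ?_ (abs_nonneg _)
        rw [inv_mul_eq_div, le_div_iff₀ hd0]
        linarith
      rw [integral_const_mul] at h1
      refine h1.trans (mul_le_mul_of_nonneg_left ?_ (inv_pos.2 hd0).le)
      exact setIntegral_mono_set (hNi _) (ae_of_all _ fun y => mul_self_nonneg _)
        (Ioc_subset_Ioc_left hR0.le).eventuallyLE
    have e3 : J R ≤ J R / n * N X := by
      calc J R = J R / n * n := by field_simp
        _ ≤ J R / n * N X := mul_le_mul_of_nonneg_left (hNmono _ _ hX) (div_nonneg (hJ0 R) hn.le)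
    rw [e1, hc₃, add_mul]
    linarith
  set T := 2 * ((2 * l + 1)⁻¹ * c₃) * E * C with hT
  have hT0 : 0 < T := by positivity
  set A := min 1 (1 / 2 / T) with hA
  have hA0 : 0 < A := lt_min one_pos (by positivity)
  have hA1 : A ^ 2 ≤ A := by
    rw [sq]; exact mul_le_of_le_one_left hA0.le (min_le_left _ _)
  have hAT : A ^ 2 * T ≤ 1 / 2 := by
    rw [← le_div_iff₀ hT0]; exact hA1.trans (min_le_right _ _)
  obtain ⟨K, hK, hKu⟩ := exists_regular_abs_le hl hq hA0
  refine ⟨A ^ l / (2 * (C * (1 + A⁻¹) * K)), A, n, R, d, by positivity, hA0, hn, hR1, hd0,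
    fun X hX => hNmono _ _ hX, hlow, ?_⟩
  filter_upwards [self_mem_nhdsWithin, (tendsto_div_abs_atTop hA0).eventually
    (eventually_ge_atTop (2 * R))] with k hk hXR
  have hk : k ≠ 0 := hk
  have hk' : 0 < |k| := abs_pos.2 hk
  obtain ⟨u, u', hu, hub', hub⟩ := hKu k hk
  set X := A / |k| with hXd
  have hX : 0 < X := by positivity
  have hkX : k ^ 2 * X ^ 2 = A ^ 2 := sq_mul_div_abs_sq hk A
  have hNX : 0 ≤ N X := hn.le.trans (hNmono _ _ hXR)
  have hInt : |(∫ y in Ioc 0 X, u₀ y * u y) - N X| ≤ 1 / 2 * N X := by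
    rw [hN]
    simp only
    rw [← integral_sub (integrableOn_mul_regular hl hu h₀ X) (hNi X), ← Real.norm_eq_abs]
    have hb : ∀ y ∈ Ioc 0 X, ‖u₀ y * u y - u₀ y * u₀ y‖ ≤
        C * X * (2 * ((2 * l + 1)⁻¹ * (k ^ 2 * J X)) * E) := by
      intro y hy
      have h1 := abs_sub_zeroEnergy_le hl hq h₀ hu hX
        (hkX.trans_le (hA1.trans (min_le_left _ _))) hy
      have h2 := hup y hy.1
      have h3 : u₀ y * u y - u₀ y * u₀ y
          = u₀ y * y ^ (l + 1) * (y ^ (-l - 1) * u y - y ^ (-l - 1) * u₀ y) := by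
        have e : y ^ (l + 1) * y ^ (-l - 1) = 1 := by rw [← Real.rpow_add hy.1]; simp
        linear_combination (-(u₀ y * (u y - u₀ y))) * e
      have h4 : C * y ^ (-l) * y ^ (l + 1) = C * y := by
        rw [mul_assoc, ← Real.rpow_add hy.1]; simp
      rw [h3, norm_mul, Real.norm_eq_abs, Real.norm_eq_abs, abs_mul,
        abs_of_pos (Real.rpow_pos_of_pos hy.1 (l + 1))]
      refine mul_le_mul ?_ h1 (abs_nonneg _) (by positivity)
      calc |u₀ y| * y ^ (l + 1) ≤ C * y ^ (-l) * y ^ (l + 1) :=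
            mul_le_mul_of_nonneg_right h2 (Real.rpow_nonneg hy.1.le _)
        _ = C * y := h4
        _ ≤ C * X := mul_le_mul_of_nonneg_left hy.2 hC0.le
    refine (norm_setIntegral_le_of_norm_le_const (by simp) hb).trans ?_
    have hvol : (volume : Measure ℝ).real (Ioc 0 X) = X := by simp [hX.le]
    rw [hvol]
    calc C * X * (2 * ((2 * l + 1)⁻¹ * (k ^ 2 * J X)) * E) * X
        ≤ C * X * (2 * ((2 * l + 1)⁻¹ * (k ^ 2 * (c₃ * N X))) * E) * X := by
          have := hJN X hXR
          gcongr
      _ = (A ^ 2 * T) * N X := by rw [hT, ← hkX]; ring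
      _ ≤ 1 / 2 * N X := mul_le_mul_of_nonneg_right hAT hNX
  have hW := wronskian_zeroEnergy hl hq h₀ hu hX
  have hW1 : k ^ 2 * (1 / 2 * N X) ≤ |u₀ X * u' X - u₀' X * u X| := by
    rw [hW, abs_neg, abs_mul, abs_of_nonneg (sq_nonneg k)]
    refine mul_le_mul_of_nonneg_left ?_ (sq_nonneg k)
    have h1 := neg_le_of_abs_le hInt
    exact le_trans (by linarith) (le_abs_self _)
  have hRX : R ≤ X := by linarith
  set f := ‖jostFunction l q k‖ with hf
  have hW2 : |u₀ X * u' X - u₀' X * u X| ≤ C * X ^ (-l) * ((1 + A⁻¹) * (K * f)) := by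
    have hXl := Real.rpow_pos_of_pos hX (-l)
    have h1 : X ^ (-l - 1) * |u X| = X ^ (-l) * (A⁻¹ * (|k| * |u X|)) := by
      rw [Real.rpow_sub_one hX.ne', hXd]
      field_simp
    calc |u₀ X * u' X - u₀' X * u X| ≤ |u₀ X| * |u' X| + |u₀' X| * |u X| := by
          rw [← abs_mul, ← abs_mul]; exact abs_sub _ _
      _ ≤ C * X ^ (-l) * |u' X| + C * X ^ (-l - 1) * |u X| := by
          have := hup X hX
          have := hup' X hRX
          gcongr
      _ = C * X ^ (-l) * (|u' X| + A⁻¹ * (|k| * |u X|)) := by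
          linear_combination C * h1
      _ ≤ C * X ^ (-l) * (K * f + A⁻¹ * (K * f)) := by gcongr
      _ = _ := by ring
  have h2 : |k| ^ l * X ^ l = A ^ l := by
    rw [← Real.mul_rpow hk'.le hX.le, hXd]
    congr 1
    field_simp
  have h3 : X ^ l * X ^ (-l) = 1 := by rw [← Real.rpow_add hX]; simp
  rw [norm_normalizedJostFunction, div_mul_eq_mul_div, div_le_iff₀ (by positivity)]
  have h4 := mul_le_mul_of_nonneg_left (hW1.trans hW2)
    (mul_nonneg (Real.rpow_nonneg hk'.le l) (Real.rpow_nonneg hX.le l))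
  change A ^ l * (k ^ 2 * N X) ≤ |k| ^ l * f * (2 * (C * (1 + A⁻¹) * K))
  calc A ^ l * (k ^ 2 * N X) = 2 * (|k| ^ l * X ^ l * (k ^ 2 * (1 / 2 * N X))) := by
        rw [← h2]; ring
    _ ≤ 2 * (|k| ^ l * X ^ l * (C * X ^ (-l) * ((1 + A⁻¹) * (K * f)))) := by linarith
    _ = _ := by linear_combination (2 * |k| ^ l * C * (1 + A⁻¹) * K * f) * h3

theorem exists_lower_bound {l : ℝ} {q : ℝ → ℝ} (hl : 0 < 2 * l + 1) (hq : MarchenkoClass q) :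
    ∃ c, 0 < c ∧ ∀ᶠ k : ℝ in 𝓝[≠] 0,
      c * |k| ^ min (l + 3 / 2) 2 ≤ ‖normalizedJostFunction l q k‖ := by
  obtain ⟨w, w', hw⟩ := exists_isRegularWith hl hq.integrableOn_mul_Ioc
  have h₀ := hw.const_mul (regularConst l)
  rw [mul_one] at h₀
  set u₀ : ℝ → ℝ := fun x => regularConst l * w x
  obtain ⟨v, hv⟩ := (tendsto_atTop_zeroEnergy hl hq h₀).1
  by_cases hv0 : v = 0
  · rw [hv0] at hv
    obtain ⟨c, A, n, R, d, hc, hA, hn, hR, hd, hN, hlow, hF⟩ :=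
      exists_lower_bound_of_resonant hl hq h₀ hv
    rcases le_or_gt (1 / 2) l with h12 | h12
    · refine ⟨c * n, by positivity, ?_⟩
      filter_upwards [hF, (tendsto_div_abs_atTop hA).eventually
        (eventually_ge_atTop (2 * R))] with k hk hX
      rw [min_eq_right (by linarith), Real.rpow_two, sq_abs]
      refine le_trans (le_of_eq_of_le (by ring) (mul_le_mul_of_nonneg_left
        (mul_le_mul_of_nonneg_left (hN _ hX) (sq_nonneg k)) hc.le)) hk
    · refine ⟨c * (d ^ 2 / 2 * A ^ (1 / 2 - l)), by positivity, ?_⟩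
      filter_upwards [hF, self_mem_nhdsWithin, (tendsto_div_abs_atTop hA).eventually
        (eventually_ge_atTop (2 * R))] with k hk hk0 hX
      have hk' : 0 < |k| := abs_pos.2 hk0
      rw [min_eq_left (by linarith)]
      set X := A / |k| with hXd
      have hX0 : 0 < X := by positivity
      have hRX : R ≤ X := by linarith
      have hR0 : 0 < R := by linarith
      have hNi := integrableOn_mul_regular hl h₀ h₀ X
      have hlowN : d ^ 2 / 2 * X ^ (1 / 2 - l) ≤ ∫ y in Ioc 0 X, u₀ y * u₀ y := by
        have hi : IntegrableOn (fun _ : ℝ => d ^ 2 * X ^ (-1 / 2 - l)) (Ioc R X) :=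
          integrableOn_const (by simp)
        have h1 : ∫ _ in Ioc R X, d ^ 2 * X ^ (-1 / 2 - l) ≤ ∫ y in Ioc R X, u₀ y * u₀ y := by
          refine setIntegral_mono_on hi (hNi.mono_set (Ioc_subset_Ioc_left hR0.le))
            measurableSet_Ioc fun y hy => ?_
          have hy1 : 1 ≤ y := hR.trans hy.1.le
          have hy0 : 0 < y := by linarith
          rw [← abs_mul_abs_self (u₀ y)]
          calc d ^ 2 * X ^ (-1 / 2 - l) ≤ d ^ 2 * y ^ (-1 / 2 - l) := by
                refine mul_le_mul_of_nonneg_left ?_ (sq_nonneg d)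
                exact Real.rpow_le_rpow_of_nonpos hy0 hy.2 (by linarith)
            _ ≤ d ^ 2 * y ^ (-l + -l) := by
                refine mul_le_mul_of_nonneg_left ?_ (sq_nonneg d)
                exact Real.rpow_le_rpow_of_exponent_le hy1 (by linarith)
            _ = (d * y ^ (-l)) * (d * y ^ (-l)) := by rw [Real.rpow_add hy0]; ring
            _ ≤ |u₀ y| * |u₀ y| := by
                have := hlow y hy.1.le
                gcongr
        rw [setIntegral_const] at h1
        have hvol : (volume : Measure ℝ).real (Ioc R X) = X - R := by simp [hRX]
        rw [hvol, smul_eq_mul] at h1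
        have e1 : X ^ (1 / 2 - l) = X * X ^ (-1 / 2 - l) := by
          rw [← Real.rpow_one_add' hX0.le (by linarith)]
          ring_nf
        calc d ^ 2 / 2 * X ^ (1 / 2 - l) = X / 2 * (d ^ 2 * X ^ (-1 / 2 - l)) := by rw [e1]; ring
          _ ≤ (X - R) * (d ^ 2 * X ^ (-1 / 2 - l)) := by
              have : X / 2 ≤ X - R := by linarith
              gcongr
          _ ≤ ∫ y in Ioc R X, u₀ y * u₀ y := h1
          _ ≤ _ := setIntegral_mono_set hNi (ae_of_all _ fun y => mul_self_nonneg _)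
              (Ioc_subset_Ioc_left hR0.le).eventuallyLE
      refine le_trans ?_ hk
      have e2 : A ^ (1 / 2 - l) * |k| ^ (l + 3 / 2) = k ^ 2 * X ^ (1 / 2 - l) := by
        rw [hXd, Real.div_rpow hA.le hk'.le, ← sq_abs k, ← Real.rpow_two, mul_div_assoc',
          eq_div_iff (Real.rpow_pos_of_pos hk' _).ne', mul_assoc, ← Real.rpow_add hk', mul_comm]
        ring_nf
      calc c * (d ^ 2 / 2 * A ^ (1 / 2 - l)) * |k| ^ (l + 3 / 2)
          = c * (k ^ 2 * (d ^ 2 / 2 * X ^ (1 / 2 - l))) := by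
            linear_combination (c * d ^ 2 / 2) * e2
        _ ≤ _ := by gcongr
  · obtain ⟨c, hc, hF⟩ := exists_lower_bound_of_ne_zero hl hq h₀ hv hv0
    refine ⟨c, hc, ?_⟩
    filter_upwards [hF, eventually_abs_le_one] with k hk hk1
    refine le_trans (mul_le_of_le_one_right hc.le ?_) hk
    exact Real.rpow_le_one (abs_nonneg _) hk1 (le_min (by linarith) zero_le_two)

end SphericalSchrodinger

end

theorem lemma2p9 (l : ℝ) (hl : -(1 / 2 : ℝ) < l) (q : ℝ → ℝ)
    (hq : SphericalSchrodinger.MarchenkoClass q) :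
    (∀ k : ℝ, k ≠ 0 → SphericalSchrodinger.normalizedJostFunction l q (k : ℂ) ≠ 0) ∧
      (fun k : ℝ => ‖SphericalSchrodinger.normalizedJostFunction l q (k : ℂ)‖⁻¹)
        =O[𝓝[≠] (0 : ℝ)] (fun k : ℝ => |k| ^ (-min (l + 3 / 2) 2)) := by
  have hl' : 0 < 2 * l + 1 := by linarith
  refine ⟨fun k hk => SphericalSchrodinger.normalizedJostFunction_ne_zero hl' hq hk, ?_⟩
  obtain ⟨c, hc, h⟩ := SphericalSchrodinger.exists_lower_bound hl' hq
  refine IsBigO.of_bound c⁻¹ ?_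
  filter_upwards [h, self_mem_nhdsWithin] with k hk hk0
  have hk' : 0 < |k| := abs_pos.2 hk0
  rw [norm_inv, norm_norm, Real.norm_of_nonneg (Real.rpow_nonneg hk'.le _),
    Real.rpow_neg hk'.le, ← mul_inv]
  exact inv_anti₀ (mul_pos hc (Real.rpow_pos_of_pos hk' _)) hk
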